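/- Let $n\ge 3$, $0<R<\infty$, and let $P:(0,R)\to[0,\infty)$ be a $C^1$ function. Let $B_R=\{x\in\mathbb{R}^n:|x|<R\}$. The following hold. (i) The following two statements are equivalent: (a) $P$ is a Hardy improving potential on $B_R$, that is, for every domain (nonempty connected open set) $\Omega\subset B_R$ and every $u\in H^1_0(\Omega)$ the functions $u^2/|x|^2$ and $P(|x|)u^2$ are integrable on $\Omega$ and $$\int_\Omega|\nabla u|^2\,dx-\Big(\frac{n-2}{2}\Big)^2\int_\Omega\frac{u^2}{|x|^2}\,dx\;\ge\;\int_\Omega P(|x|)\,u^2\,dx .$$ (b) The ordinary differential equation $y''+\frac1r y'+P(r)y=0$ has a positive $C^2$ solution on the interval $(0,R)$. (ii) Define the best constant $$\beta(P,R):=\inf_{u\in H^1_0(B_R),\ u\ne0}\frac{\displaystyle\int_{B_R}|\nabla u|^2\,dx-\Big(\frac{n-2}{2}\Big)^2\int_{B_R}\frac{u^2}{|x|^2}\,dx}{\displaystyle\int_{B_R}P(|x|)\,u^2\,dx}\in[0,\infty],$$ where the quotient is $+\infty$ if its denominator vanishes and $0$ if its denominator is infinite. Then $$\beta(P,R)=\sup\Big\{c\ge0:\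 y''+\tfrac1r y'+c\,P(r)\,y=0\ \text{ has a positive solution on }(0,R)\Big\},$$ and, for every real $c\ge0$, the equation $y''+\frac1r y'+c\,P(r)\,y=0$ has a positive solution on $(0,R)$ if and only if $c\le\beta(P,R)$ (so the supremum is a maximum whenever $\beta(P,R)<\infty$). -/

import Mathlib

open MeasureTheory Filter Topology
open scoped ENNReal NNReal ContDiff

noncomputable section

/-- `φ ∈ C_c^∞(Ω)`: smooth, with compact support contained in `Ω`. -/
def IsTestFunction {n : ℕ} (Ω : Set (EuclideanSpace ℝ (Fin n)))
    (φ : EuclideanSpace ℝ (Fin n) → ℝ) : Prop :=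
  ContDiff ℝ ∞ φ ∧ HasCompactSupport φ ∧ tsupport φ ⊆ Ω

/-- `g` is the weak gradient of `u` on the open set `Ω`. -/
def HasWeakGradient {n : ℕ} (Ω : Set (EuclideanSpace ℝ (Fin n)))
    (u : EuclideanSpace ℝ (Fin n) → ℝ)
    (g : EuclideanSpace ℝ (Fin n) → EuclideanSpace ℝ (Fin n)) : Prop :=
  LocallyIntegrableOn u Ω ∧ LocallyIntegrableOn g Ω ∧
    ∀ φ : EuclideanSpace ℝ (Fin n) → ℝ, IsTestFunction Ω φ →
      ∀ v : EuclideanSpace ℝ (Fin n),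
        ∫ x in Ω, u x * fderiv ℝ φ x v = -∫ x in Ω, inner ℝ (g x) v * φ x

/-- `u ∈ H¹(Ω)`, with weak gradient `g`. -/
def IsH1 {n : ℕ} (Ω : Set (EuclideanSpace ℝ (Fin n)))
    (u : EuclideanSpace ℝ (Fin n) → ℝ)
    (g : EuclideanSpace ℝ (Fin n) → EuclideanSpace ℝ (Fin n)) : Prop :=
  MemLp u 2 (volume.restrict Ω) ∧ MemLp g 2 (volume.restrict Ω) ∧ HasWeakGradient Ω u g

/-- `u ∈ H¹₀(Ω)`, with weak gradient `g`: the function `u` lies in `H¹(Ω)` and is a limit, in the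
`H¹(Ω)` norm, of functions in `C_c^∞(Ω)`. -/
def IsH10 {n : ℕ} (Ω : Set (EuclideanSpace ℝ (Fin n)))
    (u : EuclideanSpace ℝ (Fin n) → ℝ)
    (g : EuclideanSpace ℝ (Fin n) → EuclideanSpace ℝ (Fin n)) : Prop :=
  IsH1 Ω u g ∧
    ∃ φ : ℕ → EuclideanSpace ℝ (Fin n) → ℝ, (∀ k, IsTestFunction Ω (φ k)) ∧
      Tendsto (fun k => eLpNorm (fun x => u x - φ k x) 2 (volume.restrict Ω)) atTop (𝓝 0) ∧
      Tendsto (fun k => eLpNorm (fun x => g x - gradient (φ k) x) 2 (volume.restrict Ω))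
        atTop (𝓝 0)

/-- The Hardy functional `∫_Ω |∇u|² dx - ((n-2)/2)² ∫_Ω u²/|x|² dx`, where `g = ∇u`. -/
def hardyFunctional {n : ℕ} (Ω : Set (EuclideanSpace ℝ (Fin n)))
    (u : EuclideanSpace ℝ (Fin n) → ℝ)
    (g : EuclideanSpace ℝ (Fin n) → EuclideanSpace ℝ (Fin n)) : ℝ :=
  (∫ x in Ω, ‖g x‖ ^ 2) - (((n : ℝ) - 2) / 2) ^ 2 * ∫ x in Ω, u x ^ 2 / ‖x‖ ^ 2

/-- `P` is a Hardy improving potential on the ball `B_R` of `ℝⁿ`: on every domain `Ω ⊆ B_R` and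
for every `u ∈ H¹₀(Ω)`,
`∫_Ω |∇u|² dx - ((n-2)/2)² ∫_Ω u²/|x|² dx ≥ ∫_Ω P(|x|) u² dx`, all three integrals being finite
(that of `|∇u|²` is finite by membership in `H¹`). -/
def IsHardyImproving (n : ℕ) (R : ℝ) (P : ℝ → ℝ) : Prop :=
  ∀ Ω : Set (EuclideanSpace ℝ (Fin n)), IsOpen Ω → IsConnected Ω → Ω ⊆ Metric.ball 0 R →
    ∀ (u : EuclideanSpace ℝ (Fin n) → ℝ)
      (g : EuclideanSpace ℝ (Fin n) → EuclideanSpace ℝ (Fin n)), IsH10 Ω u g →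
      IntegrableOn (fun x => u x ^ 2 / ‖x‖ ^ 2) Ω ∧
      IntegrableOn (fun x => P ‖x‖ * u x ^ 2) Ω ∧
      hardyFunctional Ω u g ≥ ∫ x in Ω, P ‖x‖ * u x ^ 2

/-- The equation `y'' + y'/r + P(r) y = 0` has a positive (classical) solution on `(0, R)`. -/
def HasPositiveSolution (R : ℝ) (P : ℝ → ℝ) : Prop :=
  ∃ y : ℝ → ℝ, ContDiffOn ℝ 2 y (Set.Ioo 0 R) ∧
    ∀ r ∈ Set.Ioo 0 R, 0 < y r ∧ deriv (deriv y) r + 1 / r * deriv y r + P r * y r = 0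

/-- The best constant `β(P, R)`: the infimum, over `u ∈ H¹₀(B_R)` with `u ≠ 0`, of
`(∫ |∇u|² dx - ((n-2)/2)² ∫ u²/|x|² dx) / ∫ P(|x|) u² dx`, the integrals being over `B_R ⊆ ℝⁿ`.
It takes values in `[0, ∞]`: for `n ≥ 3` the numerator is nonnegative by the classical Hardy
inequality, and it is positive for `u ≠ 0` because `B_R` is bounded; the quotient is `∞` when the
denominator is `0`, and `0` when the denominator is `∞`. -/
def hardyBestConstant (n : ℕ) (R : ℝ) (P : ℝ → ℝ) : ℝ≥0∞ :=
  ⨅ (u : EuclideanSpace ℝ (Fin n) → ℝ)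
    (g : EuclideanSpace ℝ (Fin n) → EuclideanSpace ℝ (Fin n))
    (_ : IsH10 (Metric.ball 0 R) u g)
    (_ : ¬ u =ᵐ[volume.restrict (Metric.ball 0 R)] 0),
    ENNReal.ofReal (hardyFunctional (Metric.ball 0 R) u g) /
      ∫⁻ x in Metric.ball 0 R, ENNReal.ofReal (P ‖x‖ * u x ^ 2)

end

/-!
The equation `y'' + y' / r + P y = 0` is the Euler-Lagrange equation of the form
`∫ r w'² - r P w²` on `(0, R)`, and the ground state transform `u(x) = |x|^{-(n-2)/2} w(|x|)` turns
the Hardy functional with remainder `∫ P u²` into that form, so the theorem compares positivity of a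
quadratic form with existence of a positive solution, in dimension one and along rays.

A positive solution gives the inequality. Its logarithmic derivative `v = r y' / y` solves a
Riccati equation, and because `P ≥ 0` it satisfies `v ≤ 0`
(`exists_riccati_of_hasPositiveSolution`). Completing the square with `v - (n - 2) / 2` gives the
inequality on each interval `[ε, b]`; the boundary term at `ε` has the favourable sign, so nothing
has to be shown about the behaviour at the origin (`intervalIntegral_hardy_le`). Integrating over
all rays in polar coordinates, where `|∇φ|` dominates the radial derivative, proves the inequality
for test functions, and Fatou's lemma extends it to `H¹₀` (`lintegral_hardy_isH10_le`).

Conversely, the inequality on radial test functions makes the form nonnegative on `C_c^∞(0, R)`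
(`formNonneg_of_forall_isH10`), hence by mollification on primitives of bounded functions
(`FormNonneg.of_primitive`). Then a nontrivial solution has at most one zero: cut off outside two
zeros, it would be a minimizer at which the first variation does not vanish
(`FormNonneg.eq_zero_of_two_zeros`). The solutions normalized at a point `r₀` and vanishing at `a`
are therefore positive on `(a, R)`, and they converge to a positive solution as `a` tends to `0`
(`hasPositiveSolution_of_no_two_zeros`).

The statements on the best constant follow by applying this equivalence to the potentials `c P`.
The quotient must not degenerate to `0 / 0`, so the Hardy functional has to be positive on nonzero
functions; this is the inequality for the potential solved by `1 - r² / (2 R²)`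
(`hardyFunctional_pos`).
-/

namespace HardyODE

open Set

/-! ### Linear differential equations on an open interval -/

section LinearODE

variable {E : Type*} [NormedAddCommGroup E] [NormedSpace ℝ E]

/-- The Picard iterates of `x' = A(t) x`, each one the integral of `A` applied to the one before;
their sum is the solution with value `x₀` at `t₀`. -/
noncomputable def picardTerm (A : ℝ → E →L[ℝ] E) (t₀ : ℝ) (x₀ : E) : ℕ → ℝ → E
  | 0, _ => x₀
  | k + 1, t => ∫ s in t₀..t, A s (picardTerm A t₀ x₀ k s)

variable {A : ℝ → E →L[ℝ] E} {a b t₀ : ℝ} {x₀ : E}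

lemma exists_Icc_subset_Ioo {s t : ℝ} (hs : s ∈ Ioo a b) (ht : t ∈ Ioo a b) :
    ∃ c d, s ∈ Ioo c d ∧ t ∈ Ioo c d ∧ Icc c d ⊆ Ioo a b := by
  obtain ⟨c, hc⟩ := exists_between (lt_min hs.1 ht.1)
  obtain ⟨d, hd⟩ := exists_between (max_lt hs.2 ht.2)
  have h1 := lt_min_iff.1 hc.2
  have h2 := max_lt_iff.1 hd.1
  exact ⟨c, d, ⟨h1.1, h2.1⟩, ⟨h1.2, h2.2⟩, fun x hx => ⟨hc.1.trans_le hx.1, hx.2.trans_lt hd.2⟩⟩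

lemma exists_opNorm_le (hA : ContinuousOn A (Ioo a b)) {c d : ℝ} (h : Icc c d ⊆ Ioo a b) :
    ∃ M : ℝ, 0 ≤ M ∧ ∀ t ∈ Icc c d, ‖A t‖ ≤ M := by
  obtain ⟨M, hM⟩ := isCompact_Icc.exists_bound_of_continuousOn (hA.mono h)
  exact ⟨max M 0, le_max_right _ _, fun t ht => (hM t ht).trans (le_max_left _ _)⟩

/-- Two solutions of a linear equation that agree at one point agree. -/
lemma linearODE_unique (hA : ContinuousOn A (Ioo a b)) {f g : ℝ → E}
    (hf : ∀ t ∈ Ioo a b, HasDerivAt f (A t (f t)) t)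
    (hg : ∀ t ∈ Ioo a b, HasDerivAt g (A t (g t)) t) (ht₀ : t₀ ∈ Ioo a b) (h : f t₀ = g t₀) :
    EqOn f g (Ioo a b) := by
  intro t ht
  obtain ⟨c, d, hc, hd, hcd⟩ := exists_Icc_subset_Ioo ht₀ ht
  obtain ⟨M, hM0, hM⟩ := exists_opNorm_le hA hcd
  have hsub : Ioo c d ⊆ Ioo a b := Ioo_subset_Icc_self.trans hcd
  refine ODE_solution_unique_of_mem_Ioo (v := fun t x => A t x) (s := fun _ => univ)
    (K := M.toNNReal) (fun t ht => ?_) hc (fun t ht => ⟨hf t (hsub ht), mem_univ _⟩)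
    (fun t ht => ⟨hg t (hsub ht), mem_univ _⟩) h hd
  refine ((A t).lipschitz.weaken ?_).lipschitzOnWith
  rw [← NNReal.coe_le_coe, Real.coe_toNNReal _ hM0]
  exact hM t (Ioo_subset_Icc_self ht)

variable [CompleteSpace E]

lemma hasDerivAt_picardTerm (hA : ContinuousOn A (Ioo a b)) (ht₀ : t₀ ∈ Ioo a b) (k : ℕ) :
    ContinuousOn (picardTerm A t₀ x₀ k) (Ioo a b) ∧
    ∀ t ∈ Ioo a b, HasDerivAt (picardTerm A t₀ x₀ (k + 1)) (A t (picardTerm A t₀ x₀ k t)) t := by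
  have key : ∀ k, ContinuousOn (picardTerm A t₀ x₀ k) (Ioo a b) →
      ∀ t ∈ Ioo a b,
        HasDerivAt (picardTerm A t₀ x₀ (k + 1)) (A t (picardTerm A t₀ x₀ k t)) t := by
    intro k hc t ht
    have hc' : ContinuousOn (fun s => A s (picardTerm A t₀ x₀ k s)) (Ioo a b) := hA.clm_apply hc
    refine intervalIntegral.integral_hasDerivAt_right ?_ ?_ ?_
    · exact (hc'.mono (ordConnected_Ioo.uIcc_subset ht₀ ht)).intervalIntegrable
    · exact hc'.stronglyMeasurableAtFilter isOpen_Ioo t ht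
    · exact hc'.continuousAt (isOpen_Ioo.mem_nhds ht)
  induction k with
  | zero => exact ⟨continuousOn_const, key 0 continuousOn_const⟩
  | succ k ih =>
    have hc : ContinuousOn (picardTerm A t₀ x₀ (k + 1)) (Ioo a b) :=
      fun t ht => (ih.2 t ht).continuousAt.continuousWithinAt
    exact ⟨hc, key _ hc⟩

lemma norm_picardTerm_le (hA : ContinuousOn A (Ioo a b)) (ht₀ : t₀ ∈ Ioo a b) {c d M : ℝ}
    (hc : t₀ ∈ Ioo c d) (hcd : Icc c d ⊆ Ioo a b) (hM0 : 0 ≤ M) (hM : ∀ t ∈ Icc c d, ‖A t‖ ≤ M)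
    (k : ℕ) :
    ∀ t ∈ Ioo c d, ‖picardTerm A t₀ x₀ k t‖ ≤ ‖x₀‖ * (M ^ k * |t - t₀| ^ k / k.factorial) := by
  induction k with
  | zero => intro t ht; simp [picardTerm]
  | succ k ih =>
    intro t ht
    have hsub : uIcc t₀ t ⊆ Ioo c d := ordConnected_Ioo.uIcc_subset hc ht
    have h1 : ∀ s ∈ uIoc t₀ t, ‖A s (picardTerm A t₀ x₀ k s)‖
        ≤ M * (‖x₀‖ * (M ^ k / k.factorial)) * |s - t₀| ^ k := by
      intro s hs
      have hs' := hsub (uIoc_subset_uIcc hs)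
      refine ((A s).le_opNorm _).trans ?_
      refine (mul_le_mul (hM s (Ioo_subset_Icc_self hs')) (ih s hs') (norm_nonneg _) hM0).trans
        (le_of_eq ?_)
      ring
    have hcont : ContinuousOn (fun s => A s (picardTerm A t₀ x₀ k s)) (uIcc t₀ t) :=
      (hA.clm_apply (hasDerivAt_picardTerm hA ht₀ k).1).mono
        (hsub.trans (Ioo_subset_Icc_self.trans hcd))
    calc ‖picardTerm A t₀ x₀ (k + 1) t‖
        ≤ ∫ s in uIoc t₀ t, ‖A s (picardTerm A t₀ x₀ k s)‖ :=
          intervalIntegral.norm_integral_le_integral_norm_uIoc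
      _ ≤ ∫ s in uIoc t₀ t, M * (‖x₀‖ * (M ^ k / k.factorial)) * |s - t₀| ^ k := by
          refine setIntegral_mono_on ?_ ?_ measurableSet_uIoc h1
          · exact (hcont.intervalIntegrable.norm).def'
          · exact (Continuous.intervalIntegrable (by fun_prop) t₀ t).def'
      _ = _ := by
          rw [integral_const_mul, integral_pow_abs_sub_uIoc, Nat.factorial_succ]
          push_cast
          field_simp
          ring

/-- A linear equation with continuous coefficients on an open interval has a solution on the whole
interval with prescribed value at a point. -/
lemma exists_linearODE_solution (hA : ContinuousOn A (Ioo a b)) (ht₀ : t₀ ∈ Ioo a b) (x₀ : E) :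
    ∃ f : ℝ → E, f t₀ = x₀ ∧ ∀ t ∈ Ioo a b, HasDerivAt f (A t (f t)) t := by
  have h0 : ∀ k, picardTerm A t₀ x₀ (k + 1) t₀ = 0 := fun k => by simp [picardTerm]
  refine ⟨fun t => x₀ + ∑' k, picardTerm A t₀ x₀ (k + 1) t, by simp [h0], fun t ht => ?_⟩
  obtain ⟨c, d, hc, hd, hcd⟩ := exists_Icc_subset_Ioo ht₀ ht
  obtain ⟨M, hM0, hM⟩ := exists_opNorm_le hA hcd
  have hsub : Ioo c d ⊆ Ioo a b := Ioo_subset_Icc_self.trans hcd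
  have hb : ∀ k, ∀ s ∈ Ioo c d,
      ‖picardTerm A t₀ x₀ k s‖ ≤ ‖x₀‖ * ((M * (d - c)) ^ k / k.factorial) := by
    intro k s hs
    refine (norm_picardTerm_le hA ht₀ hc hcd hM0 hM k s hs).trans ?_
    rw [mul_pow]
    have : |s - t₀| ≤ d - c := abs_sub_le_iff.2 ⟨by linarith [hs.2, hc.1], by linarith [hs.1, hc.2]⟩
    gcongr
  have hsum : Summable fun k : ℕ => ‖x₀‖ * ((M * (d - c)) ^ k / k.factorial) :=
    (Real.summable_pow_div_factorial _).mul_left _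
  have hs : Summable fun k => picardTerm A t₀ x₀ k t :=
    Summable.of_norm_bounded hsum fun k => hb k t hd
  have h1 : HasDerivAt (fun t => ∑' k, picardTerm A t₀ x₀ (k + 1) t)
      (∑' k, A t (picardTerm A t₀ x₀ k t)) t := by
    refine hasDerivAt_tsum_of_isPreconnected
      (g' := fun k s => A s (picardTerm A t₀ x₀ k s)) (hsum.mul_left M) isOpen_Ioo isPreconnected_Ioo
      (fun k s hs => (hasDerivAt_picardTerm hA ht₀ k).2 s (hsub hs)) (fun k s hs => ?_) hc
      (by simp [h0]) hd
    exact ((A s).le_opNorm _).trans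
      (mul_le_mul (hM s (Ioo_subset_Icc_self hs)) (hb k s hs) (norm_nonneg _) hM0)
  have h2 : ∑' k, A t (picardTerm A t₀ x₀ k t)
      = A t (x₀ + ∑' k, picardTerm A t₀ x₀ (k + 1) t) := by
    rw [← (A t).map_tsum hs, hs.tsum_eq_zero_add]
    rfl
  rw [← h2]
  exact h1.const_add x₀

end LinearODE

/-! ### The radial equation as a first-order system -/

section RadialEquation

/-- The pair `(y, z)` solves `y' = z / r`, `z' = -r P y` on `(0, R)`, which is the equation
`y'' + y' / r + P y = 0` with `z = r y'`. -/
def IsRadialSolution (R : ℝ) (P y z : ℝ → ℝ) : Prop :=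
  ∀ r ∈ Ioo 0 R, HasDerivAt y (z r / r) r ∧ HasDerivAt z (-(r * (P r * y r))) r

/-- The coefficient matrix of the first-order system. -/
noncomputable def radialMatrix (P : ℝ → ℝ) (r : ℝ) : ℝ × ℝ →L[ℝ] ℝ × ℝ :=
  (r⁻¹ • ContinuousLinearMap.snd ℝ ℝ ℝ).prod ((-(r * P r)) • ContinuousLinearMap.fst ℝ ℝ ℝ)

variable {R : ℝ} {P y z : ℝ → ℝ}

lemma continuousOn_radialMatrix (hP : ContinuousOn P (Ioo 0 R)) :
    ContinuousOn (radialMatrix P) (Ioo 0 R) := by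
  have h1 : ContinuousOn (fun r : ℝ => r⁻¹) (Ioo 0 R) :=
    continuousOn_inv₀.mono fun r hr => hr.1.ne'
  have h2 : ContinuousOn (fun r : ℝ => -(r * P r)) (Ioo 0 R) := (continuousOn_id.mul hP).neg
  have h := (h1.smul (continuousOn_const (c := ContinuousLinearMap.snd ℝ ℝ ℝ))).prodMk
    (h2.smul (continuousOn_const (c := ContinuousLinearMap.fst ℝ ℝ ℝ)))
  exact (ContinuousLinearMap.prodₗᵢ ℝ).continuous.comp_continuousOn h

lemma isRadialSolution_iff :
    IsRadialSolution R P y z ↔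
      ∀ r ∈ Ioo 0 R, HasDerivAt (fun r => (y r, z r)) (radialMatrix P r (y r, z r)) r := by
  have key : ∀ r, radialMatrix P r (y r, z r) = (z r / r, -(r * (P r * y r))) := by
    intro r
    simp only [radialMatrix, ContinuousLinearMap.prod_apply, smul_apply,
      ContinuousLinearMap.coe_snd', ContinuousLinearMap.coe_fst', smul_eq_mul, Prod.mk.injEq]
    constructor <;> ring
  refine forall₂_congr fun r _ => ?_
  rw [key]
  exact ⟨fun h => h.1.prodMk h.2, fun h => ⟨h.fst, h.snd⟩⟩

lemma exists_isRadialSolution (hP : ContinuousOn P (Ioo 0 R)) {r₀ : ℝ} (hr₀ : r₀ ∈ Ioo 0 R)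
    (y₀ z₀ : ℝ) : ∃ y z, IsRadialSolution R P y z ∧ y r₀ = y₀ ∧ z r₀ = z₀ := by
  obtain ⟨f, hf0, hf⟩ :=
    exists_linearODE_solution (continuousOn_radialMatrix hP) hr₀ (y₀, z₀)
  exact ⟨fun r => (f r).1, fun r => (f r).2, isRadialSolution_iff.2 hf, by simp [hf0],
    by simp [hf0]⟩

lemma IsRadialSolution.eq_zero (h : IsRadialSolution R P y z) (hP : ContinuousOn P (Ioo 0 R))
    {r₀ : ℝ} (hr₀ : r₀ ∈ Ioo 0 R) (hy : y r₀ = 0) (hz : z r₀ = 0) :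
    ∀ r ∈ Ioo 0 R, y r = 0 := by
  intro r hr
  have := linearODE_unique (continuousOn_radialMatrix hP) (isRadialSolution_iff.1 h)
    (g := fun _ => 0) (fun t _ => by simpa using hasDerivAt_const t (0 : ℝ × ℝ)) hr₀
    (by simp [hy, hz]) hr
  exact congrArg Prod.fst this

lemma IsRadialSolution.sub_smul {y₁ z₁ : ℝ → ℝ} (h : IsRadialSolution R P y z)
    (h₁ : IsRadialSolution R P y₁ z₁) (c : ℝ) :
    IsRadialSolution R P (fun r => y r - c * y₁ r) (fun r => z r - c * z₁ r) := by
  intro r hr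
  constructor
  · convert! (h r hr).1.sub ((h₁ r hr).1.const_mul c) using 1; ring
  · convert! (h r hr).2.sub ((h₁ r hr).2.const_mul c) using 1; ring

lemma IsRadialSolution.hasPositiveSolution (h : IsRadialSolution R P y z)
    (hP : ContinuousOn P (Ioo 0 R)) (hy : ∀ r ∈ Ioo 0 R, 0 < y r) : HasPositiveSolution R P := by
  have hyc : ContinuousOn y (Ioo 0 R) := fun r hr => (h r hr).1.continuousAt.continuousWithinAt
  have hzc : ContinuousOn z (Ioo 0 R) := fun r hr => (h r hr).2.continuousAt.continuousWithinAt
  have hd : ∀ r ∈ Ioo 0 R, deriv y r = z r / r := fun r hr => (h r hr).1.deriv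
  have hdd : ∀ r ∈ Ioo 0 R,
      HasDerivAt (deriv y) (-(P r * y r) - z r / r ^ 2) r := by
    intro r hr
    have hne : r ≠ 0 := hr.1.ne'
    have h1 := (h r hr).2.div (hasDerivAt_id r) hne
    have h2 : deriv y =ᶠ[𝓝 r] z / id :=
      (eventually_of_mem (isOpen_Ioo.mem_nhds hr) hd)
    convert! h1.congr_of_eventuallyEq h2 using 1
    simp only [id]
    field_simp
  refine ⟨y, ?_, fun r hr => ⟨hy r hr, ?_⟩⟩
  · have e2 : (2 : WithTop ℕ∞) = 1 + 1 := by norm_num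
    rw [e2, contDiffOn_succ_iff_deriv_of_isOpen isOpen_Ioo]
    refine ⟨fun r hr => (h r hr).1.differentiableAt.differentiableWithinAt, by simp, ?_⟩
    have e1 : (1 : WithTop ℕ∞) = 0 + 1 := by norm_num
    rw [e1, contDiffOn_succ_iff_deriv_of_isOpen isOpen_Ioo]
    refine ⟨fun r hr => (hdd r hr).differentiableAt.differentiableWithinAt, by simp, ?_⟩
    rw [contDiffOn_zero]
    have : ContinuousOn (fun r => -(P r * y r) - z r / r ^ 2) (Ioo 0 R) :=
      ((hP.mul hyc).neg).sub (hzc.div (by fun_prop) fun r hr => pow_ne_zero _ hr.1.ne')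
    exact this.congr fun r hr => (hdd r hr).deriv
  · rw [(hdd r hr).deriv, hd r hr]
    field_simp
    ring

/-- If no nontrivial solution vanishes at two points, some solution is positive: with `u`, `v` the
solutions with data `(1, 0)` and `(0, 1)` at `r₀`, it is `u - λ v` where `λ` is the supremum of
`u / v` over `(0, r₀)`, that is, the limit of the solutions equal to `1` at `r₀` that vanish at a
point tending to `0`. -/
lemma hasPositiveSolution_of_no_two_zeros (hR : 0 < R) (hP : ContinuousOn P (Ioo 0 R))
    (H : ∀ y z, IsRadialSolution R P y z → ∀ a ∈ Ioo 0 R, ∀ b ∈ Ioo 0 R, a < b →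
      y a = 0 → y b = 0 → ∀ r ∈ Ioo 0 R, y r = 0) : HasPositiveSolution R P := by
  have hr₀ : R / 2 ∈ Ioo 0 R := ⟨by linarith, by linarith⟩
  set r₀ := R / 2
  obtain ⟨u, zu, hu, hu0, hzu0⟩ := exists_isRadialSolution hP hr₀ 1 0
  obtain ⟨v, zv, hv, hv0, hzv0⟩ := exists_isRadialSolution hP hr₀ 0 1
  have cont : ∀ {y z : ℝ → ℝ}, IsRadialSolution R P y z → ContinuousOn y (Ioo 0 R) :=
    fun h r hr => (h r hr).1.continuousAt.continuousWithinAt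
  have hvd : HasDerivAt v (1 / r₀) r₀ := by simpa [hzv0] using (hv r₀ hr₀).1
  have hpos : 0 < 1 / r₀ := one_div_pos.2 hr₀.1
  -- `v` vanishes only at `r₀`
  have hvne : ∀ r ∈ Ioo 0 R, r ≠ r₀ → v r ≠ 0 := by
    intro r hr hne h0
    have hz : ∀ r ∈ Ioo 0 R, v r = 0 := by
      rcases lt_or_gt_of_ne hne with h | h
      · exact H v zv hv r hr r₀ hr₀ h h0 hv0
      · exact H v zv hv r₀ hr₀ r hr h hv0 h0
    have h1 : HasDerivAt v 0 r₀ := (hasDerivAt_const r₀ (0 : ℝ)).congr_of_eventuallyEq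
      (eventually_of_mem (isOpen_Ioo.mem_nhds hr₀) hz)
    exact hpos.ne' (hvd.unique h1)
  have hslope := (hasDerivAt_iff_tendsto_slope.1 hvd).eventually_const_lt hpos
  rw [eventually_nhdsWithin_iff] at hslope
  obtain ⟨δ, hδ, hδ'⟩ := Metric.eventually_nhds_iff.1 hslope
  have sgn : ∀ r, dist r r₀ < δ → r ≠ r₀ → 0 < (v r) / (r - r₀) := by
    intro r hr hne
    have := hδ' hr hne
    rwa [slope_def_field, hv0, sub_zero] at this
  have hvpos : ∀ r ∈ Ioo r₀ R, 0 < v r := by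
    intro r hr
    by_contra hcon
    have hr' : r ∈ Ioo 0 R := ⟨hr₀.1.trans hr.1, hr.2⟩
    obtain ⟨s, hs1, hs2⟩ := exists_between (lt_min hr.1 (lt_add_of_pos_right r₀ hδ))
    have hs3 := lt_min_iff.1 hs2
    have hvs : 0 < v s := by
      have := sgn s (by rw [Real.dist_eq, abs_of_pos (by linarith)]; linarith) hs1.ne'
      exact (div_pos_iff_of_pos_right (by linarith)).1 this
    obtain ⟨t, ht, ht0⟩ := intermediate_value_Icc' hs3.1.le
      ((cont hv).mono fun x hx => ⟨hr₀.1.trans (hs1.trans_le hx.1), hx.2.trans_lt hr.2⟩)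
      ⟨not_lt.1 hcon, hvs.le⟩
    exact hvne t ⟨hr₀.1.trans (hs1.trans_le ht.1), ht.2.trans_lt hr.2⟩
      (hs1.trans_le ht.1).ne' ht0
  have hvneg : ∀ r ∈ Ioo 0 r₀, v r < 0 := by
    intro r hr
    by_contra hcon
    have hr' : r ∈ Ioo 0 R := ⟨hr.1, hr.2.trans hr₀.2⟩
    obtain ⟨s, hs1, hs2⟩ := exists_between (max_lt hr.2 (sub_lt_self r₀ hδ))
    have hs3 := max_lt_iff.1 hs1
    have hvs : v s < 0 := by
      have := sgn s (by rw [Real.dist_eq, abs_of_neg (by linarith)]; linarith) hs2.ne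
      rcases div_pos_iff.1 this with h | h
      · linarith [h.2]
      · exact h.1
    obtain ⟨t, ht, ht0⟩ := intermediate_value_Icc' hs3.1.le
      ((cont hv).mono fun x hx => ⟨hr.1.trans_le hx.1, hx.2.trans_lt (hs2.trans hr₀.2)⟩)
      ⟨hvs.le, not_lt.1 hcon⟩
    exact hvne t ⟨hr.1.trans_le ht.1, ht.2.trans_lt (hs2.trans hr₀.2)⟩
      (ht.2.trans_lt hs2).ne ht0
  -- the solution that vanishes at `a < r₀` and equals `1` at `r₀` stays positive on `(r₀, R)`
  have hcomp : ∀ a ∈ Ioo 0 r₀, ∀ d ∈ Ioo r₀ R, u a / v a ≤ u d / v d := by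
    intro a ha d hd
    have ha' : a ∈ Ioo 0 R := ⟨ha.1, ha.2.trans hr₀.2⟩
    set c := u a / v a
    have hs := hu.sub_smul hv c
    have hya : u a - c * v a = 0 := by
      rw [div_mul_cancel₀ _ (hvneg a ha).ne]; ring
    have hy0 : u r₀ - c * v r₀ = 1 := by rw [hu0, hv0]; ring
    rw [le_div_iff₀ (hvpos d hd)]
    by_contra hcon
    obtain ⟨t, ht, ht0⟩ := intermediate_value_Icc' hd.1.le
      ((cont hs).mono fun x hx => ⟨hr₀.1.trans_le hx.1, hx.2.trans_lt hd.2⟩)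
      (show (0 : ℝ) ∈ Icc _ _ from ⟨by linarith, by linarith⟩)
    have := H _ _ hs a ha' t ⟨hr₀.1.trans_le ht.1, ht.2.trans_lt hd.2⟩ (ha.2.trans_le ht.1)
      hya ht0 r₀ hr₀
    linarith
  have hd₀ : (r₀ + R) / 2 ∈ Ioo r₀ R := ⟨by linarith [hr₀.2], by linarith [hr₀.2]⟩
  have ha₀ : r₀ / 2 ∈ Ioo 0 r₀ := ⟨by linarith [hr₀.1], by linarith [hr₀.1]⟩
  have hbdd : BddAbove ((fun a => u a / v a) '' Ioo 0 r₀) :=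
    ⟨_, by rintro _ ⟨a, ha, rfl⟩; exact hcomp a ha _ hd₀⟩
  set l := sSup ((fun a => u a / v a) '' Ioo 0 r₀)
  have hs := hu.sub_smul hv l
  have hy0 : u r₀ - l * v r₀ = 1 := by rw [hu0, hv0]; ring
  have hnn : ∀ r ∈ Ioo 0 R, 0 ≤ u r - l * v r := by
    intro r hr
    rcases lt_trichotomy r r₀ with h | h | h
    · have h1 : u r / v r ≤ l := le_csSup hbdd ⟨r, ⟨hr.1, h⟩, rfl⟩
      rw [div_le_iff_of_neg (hvneg r ⟨hr.1, h⟩)] at h1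
      linarith
    · rw [h, hy0]; norm_num
    · have h1 : l ≤ u r / v r := csSup_le ⟨_, _, ha₀, rfl⟩
        (by rintro _ ⟨a, ha, rfl⟩; exact hcomp a ha _ ⟨h, hr.2⟩)
      rw [le_div_iff₀ (hvpos r ⟨h, hr.2⟩)] at h1
      linarith
  refine hs.hasPositiveSolution hP fun r hr => (hnn r hr).lt_of_ne fun h0 => ?_
  -- a zero of a nonnegative solution is a minimum, so the derivative vanishes there as well
  have hmin : IsLocalMin (fun r => u r - l * v r) r :=
    eventually_of_mem (isOpen_Ioo.mem_nhds hr) fun x hx => by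
      simpa only [← h0] using hnn x hx
  have hz := hmin.hasDerivAt_eq_zero (hs r hr).1
  rw [div_eq_zero_iff, or_iff_left hr.1.ne'] at hz
  have := hs.eq_zero hP hr h0.symm hz r₀ hr₀
  linarith

/-! ### The quadratic form on radial test functions -/

/-- The form `∫ r w'² - r P w²` on `(0, R)` is nonnegative on `C_c^∞(0, R)`. -/
def FormNonneg (R : ℝ) (P : ℝ → ℝ) : Prop :=
  ∀ w : ℝ → ℝ, ContDiff ℝ ∞ w → HasCompactSupport w → tsupport w ⊆ Ioo 0 R →
    ∫ r in Ioo 0 R, r * (P r * w r ^ 2) ≤ ∫ r in Ioo 0 R, r * deriv w r ^ 2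

/-- Mollification of a bounded function of mean zero with compact support: the approximations are
smooth, have mean zero and the same bound, and their supports lie in a fixed interval. -/
lemma exists_smooth_approx {g : ℝ → ℝ} {c d M δ : ℝ} (hg : Measurable g) (hM : ∀ x, |g x| ≤ M)
    (hsupp : ∀ x, x ∉ Icc c d → g x = 0) (hg0 : ∫ x, g x = 0) (hδ : 0 < δ) :
    ∃ G : ℕ → ℝ → ℝ, (∀ k, ContDiff ℝ ∞ (G k)) ∧ (∀ k x, |G k x| ≤ M) ∧
      (∀ k x, x ∉ Icc (c - δ) (d + δ) → G k x = 0) ∧ (∀ k, ∫ x, G k x = 0) ∧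
      ∀ᵐ x, Tendsto (fun k => G k x) atTop (𝓝 (g x)) := by
  have hM0 : 0 ≤ M := (abs_nonneg _).trans (hM 0)
  have hgi : Integrable g := by
    have h1 : IntegrableOn g (Icc c d) :=
      Measure.integrableOn_of_bounded (M := M) (by simp) hg.aestronglyMeasurable
        (Eventually.of_forall fun x => by simpa using hM x)
    refine (integrableOn_iff_integrable_of_support_subset fun x hx => ?_).1 h1
    by_contra h
    exact hx (hsupp x h)
  let φ : ℕ → ContDiffBump (0 : ℝ) := fun k =>
    { rIn := δ / (k + 1) / 2
      rOut := δ / (k + 1)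
      rIn_pos := by positivity
      rIn_lt_rOut := half_lt_self (by positivity) }
  have hout : ∀ k, (φ k).rOut ≤ δ := fun k => div_le_self hδ.le (by simp)
  have conv : ∀ k x z₀ ε, 0 ≤ ε → (∀ y ∈ Metric.ball x (φ k).rOut, dist (g y) z₀ ≤ ε) →
      dist (convolution ((φ k).normed volume) g (ContinuousLinearMap.lsmul ℝ ℝ) volume x) z₀ ≤ ε :=
    fun k x z₀ ε hε h => dist_convolution_le hε (φ k).support_normed_eq.subset
      (φ k).nonneg_normed (φ k).integral_normed hg.aestronglyMeasurable h
  refine ⟨fun k => convolution ((φ k).normed volume) g (ContinuousLinearMap.lsmul ℝ ℝ) volume,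
    fun k => ?_, fun k x => ?_, fun k x hx => ?_, fun k => ?_, ?_⟩
  · exact (φ k).hasCompactSupport_normed.contDiff_convolution_left _ (φ k).contDiff_normed
      hgi.locallyIntegrable
  · simpa using conv k x 0 M hM0 fun y _ => by simpa using hM y
  · have := conv k x 0 0 le_rfl fun y hy => by
      rw [hsupp y, dist_self]
      rw [Metric.mem_ball, Real.dist_eq, abs_lt] at hy
      contrapose! hx
      have := hout k
      exact ⟨by linarith [hx.1, hy.2], by linarith [hx.2, hy.1]⟩
    simpa using this
  · rw [integral_convolution (ContinuousLinearMap.lsmul ℝ ℝ) (φ k).integrable_normed hgi, hg0]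
    simp
  · refine ContDiffBump.ae_convolution_tendsto_right_of_locallyIntegrable (K := 2) ?_
      (Eventually.of_forall fun k => ?_) hgi.locallyIntegrable
    · have := (tendsto_one_div_add_atTop_nhds_zero_nat (𝕜 := ℝ)).const_mul δ
      simpa [φ, div_eq_mul_inv] using this
    · simp only [φ]; linarith

/-- A bounded function of mean zero, supported in a compact subinterval of `(0, R)`, is the
derivative of an admissible Lipschitz function: the form is nonnegative on it as well. -/
lemma FormNonneg.of_primitive (hQ : FormNonneg R P) (hP : ContinuousOn P (Ioo 0 R))
    {g w : ℝ → ℝ} {c d M : ℝ} (hc : 0 < c) (hd : d < R) (hg : Measurable g)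
    (hM : ∀ x, |g x| ≤ M) (hsupp : ∀ x, x ∉ Icc c d → g x = 0) (hg0 : ∫ x, g x = 0)
    (hw : ∀ t ∈ Ioo 0 R, w t = ∫ s in (0 : ℝ)..t, g s) :
    ∫ r in Ioo 0 R, r * (P r * w r ^ 2) ≤ ∫ r in Ioo 0 R, r * g r ^ 2 := by
  have hM0 : 0 ≤ M := (abs_nonneg _).trans (hM 0)
  obtain ⟨δ, hδ, hδ'⟩ := exists_between (lt_min hc (sub_pos.2 hd))
  rw [lt_min_iff] at hδ'
  obtain ⟨G, hGs, hGM, hGsupp, hG0, hGlim⟩ := exists_smooth_approx hg hM hsupp hg0 hδ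
  set lo := c - δ
  set hi := d + δ
  have hlo : 0 < lo := by simp only [lo]; linarith
  have hhi : hi < R := by simp only [hi]; linarith
  let W : ℕ → ℝ → ℝ := fun k t => ∫ s in (0 : ℝ)..t, G k s
  have hGi : ∀ k a b, IntervalIntegrable (G k) volume a b := fun k a b =>
    (hGs k).continuous.intervalIntegrable a b
  have hWd : ∀ k t, HasDerivAt (W k) (G k t) t := fun k t =>
    intervalIntegral.integral_hasDerivAt_right (hGi k 0 t)
      ((hGs k).continuous.stronglyMeasurableAtFilter _ _) (hGs k).continuous.continuousAt
  have hWderiv : ∀ k, deriv (W k) = G k := fun k => funext fun t => (hWd k t).deriv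
  have hWs : ∀ k, ContDiff ℝ ∞ (W k) := fun k => by
    rw [contDiff_infty_iff_deriv, hWderiv]
    exact ⟨fun t => (hWd k t).differentiableAt, hGs k⟩
  have hWz : ∀ k x, x ∉ Icc lo hi → W k x = 0 := by
    intro k x hx
    have hint : ∀ u v, (∀ s ∈ uIcc u v, s ∉ Icc lo hi) → ∫ s in u..v, G k s = 0 := by
      intro u v h
      rw [intervalIntegral.integral_congr (g := fun _ => 0) fun s hs => hGsupp k s (h s hs)]
      simp
    by_cases h1 : x < lo
    · refine hint 0 x fun s hs hs' => ?_
      rw [mem_uIcc] at hs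
      rcases hs with h | h <;> linarith [hs'.1, h.2]
    · have h2 : hi < x := by
        by_contra h2
        exact hx ⟨not_lt.1 h1, not_lt.1 h2⟩
      have hx0 : 0 ≤ x := by linarith [not_lt.1 h1]
      simp only [W]
      rw [intervalIntegral.integral_of_le hx0, setIntegral_eq_integral_of_forall_compl_eq_zero,
        hG0 k]
      intro s hs
      refine hGsupp k s fun hs' => hs ⟨by linarith [hs'.1], by linarith [hs'.2]⟩
  have hWts : ∀ k, tsupport (W k) ⊆ Icc lo hi := fun k =>
    closure_minimal (fun x hx => by_contra fun h => hx (hWz k x h)) isClosed_Icc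
  have hIcc : Icc lo hi ⊆ Ioo 0 R := fun x hx => ⟨hlo.trans_le hx.1, hx.2.trans_lt hhi⟩
  have main : ∀ k, ∫ r in Ioo 0 R, r * (P r * W k r ^ 2) ≤ ∫ r in Ioo 0 R, r * G k r ^ 2 := by
    intro k
    rw [← hWderiv k]
    exact hQ (W k) (hWs k) (HasCompactSupport.of_support_subset_isCompact isCompact_Icc
      ((subset_tsupport _).trans (hWts k))) ((hWts k).trans hIcc)
  have hWb : ∀ k, ∀ x ∈ Ioo 0 R, |W k x| ≤ M * R := by
    intro k x hx
    have := intervalIntegral.norm_integral_le_of_norm_le_const (a := 0) (b := x) (f := G k)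
      (C := M) fun s _ => by simpa using hGM k s
    rw [sub_zero, abs_of_pos hx.1] at this
    exact this.trans (mul_le_mul_of_nonneg_left hx.2.le hM0)
  have hWlim : ∀ x ∈ Ioo 0 R, Tendsto (fun k => W k x) atTop (𝓝 (w x)) := by
    intro x hx
    rw [hw x hx]
    refine intervalIntegral.tendsto_integral_filter_of_dominated_convergence (fun _ => M)
      (Eventually.of_forall fun k => (hGs k).continuous.aestronglyMeasurable)
      (Eventually.of_forall fun k => Eventually.of_forall fun s _ => by simpa using hGM k s)
      (by simp) (hGlim.mono fun s hs _ => hs)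
  obtain ⟨B, hB⟩ := isCompact_Icc.exists_bound_of_continuousOn (hP.mono hIcc)
  have hPm : AEStronglyMeasurable P (volume.restrict (Ioo 0 R)) :=
    hP.aestronglyMeasurable measurableSet_Ioo
  have hidm : AEStronglyMeasurable (fun r : ℝ => r) (volume.restrict (Ioo 0 R)) :=
    measurable_id.aestronglyMeasurable
  have hconst : ∀ C : ℝ, Integrable (fun _ => C) (volume.restrict (Ioo 0 R)) := fun C => by
    exact integrable_const C
  refine le_of_tendsto_of_tendsto' (b := atTop) ?_ ?_ main
  · refine tendsto_integral_of_dominated_convergence (fun _ => R * (|B| * (M * R) ^ 2))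
      (fun k => hidm.mul (hPm.mul ((hWs k).continuous.aestronglyMeasurable.pow 2))) (hconst _)
      (fun k => ?_) ?_
    · filter_upwards [ae_restrict_mem measurableSet_Ioo] with r hr
      have hR0 : 0 < R := hr.1.trans hr.2
      by_cases hr' : r ∈ Icc lo hi
      · rw [norm_mul, norm_mul, Real.norm_of_nonneg hr.1.le, norm_pow]
        refine mul_le_mul hr.2.le (mul_le_mul ((hB r hr').trans (le_abs_self B)) ?_ (by positivity)
          (abs_nonneg _)) (by positivity) hR0.le
        exact pow_le_pow_left₀ (norm_nonneg _) (hWb k r hr) 2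
      · rw [hWz k r hr']
        simp only [ne_eq, OfNat.ofNat_ne_zero, not_false_eq_true, zero_pow, mul_zero, norm_zero]
        positivity
    · filter_upwards [ae_restrict_mem measurableSet_Ioo] with r hr
      exact (((hWlim r hr).pow 2).const_mul _).const_mul _
  · refine tendsto_integral_of_dominated_convergence (fun _ => R * M ^ 2)
      (fun k => hidm.mul ((hGs k).continuous.aestronglyMeasurable.pow 2)) (hconst _)
      (fun k => ?_) ?_
    · filter_upwards [ae_restrict_mem measurableSet_Ioo] with r hr
      rw [norm_mul, Real.norm_of_nonneg hr.1.le, norm_pow]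
      exact mul_le_mul hr.2.le (pow_le_pow_left₀ (norm_nonneg _) (hGM k r) 2) (by positivity)
        (hr.1.trans hr.2).le
    · filter_upwards [ae_restrict_of_ae hGlim] with r hr
      exact (hr.pow 2).const_mul _

lemma eq_zero_of_forall_nonneg {p q : ℝ} (h : ∀ ε : ℝ, 0 ≤ 2 * ε * p + ε ^ 2 * q) : p = 0 := by
  have hq : 0 < |q| + 1 := by positivity
  have h1 := h (-p / (|q| + 1))
  by_contra hp
  have hp2 : 0 < p ^ 2 := by positivity
  have e : 2 * (-p / (|q| + 1)) * p + (-p / (|q| + 1)) ^ 2 * q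
      = p ^ 2 * (q - 2 * (|q| + 1)) / (|q| + 1) ^ 2 := by
    field_simp
    ring
  rw [e, div_nonneg_iff] at h1
  have h2 := le_abs_self q
  have h3 : p ^ 2 * (q - 2 * (|q| + 1)) < 0 :=
    mul_neg_of_pos_of_neg hp2 (by linarith [abs_nonneg q])
  rcases h1 with h1 | h1
  · linarith [h1.1]
  · have : 0 < (|q| + 1) ^ 2 := by positivity
    linarith [h1.2]

lemma integral_add_mul_add_mul {μ : Measure ℝ} {f g h : ℝ → ℝ} (hf : Integrable f μ)
    (hg : Integrable g μ) (hh : Integrable h μ) (c d : ℝ) :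
    ∫ x, (f x + c * g x + d * h x) ∂μ = (∫ x, f x ∂μ) + c * (∫ x, g x ∂μ) + d * ∫ x, h x ∂μ := by
  rw [← integral_const_mul, ← integral_const_mul, ← integral_add hf (hg.const_mul c)]
  exact integral_add (hf.add (hg.const_mul c)) (hh.const_mul d)

lemma integral_indicator_deriv_of_endpoints_eq_zero {f f' : ℝ → ℝ} {a b t : ℝ} (ha : 0 ≤ a) (hab : a ≤ b)
    (hf : ∀ r ∈ Icc a b, HasDerivAt f (f' r) r) (hf' : ContinuousOn f' (Icc a b))
    (hfa : f a = 0) (hfb : f b = 0) (ht : 0 ≤ t) :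
    ∫ s in (0 : ℝ)..t, (Ioc a b).indicator f' s = (Ioc a b).indicator f t := by
  rw [intervalIntegral.integral_of_le ht, setIntegral_indicator measurableSet_Ioc, Ioc_inter_Ioc,
    max_eq_right ha]
  have key : ∀ x ∈ Icc a b, ∫ s in Ioc a x, f' s = f x := by
    intro x hx
    have hsub : uIcc a x ⊆ Icc a b := by
      rw [uIcc_of_le hx.1]; exact Icc_subset_Icc_right hx.2
    rw [← intervalIntegral.integral_of_le hx.1,
      intervalIntegral.integral_eq_sub_of_hasDerivAt (fun s hs => hf s (hsub hs))
      (hf'.mono hsub).intervalIntegrable, hfa, sub_zero]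
  by_cases h1 : t ∈ Ioc a b
  · rw [indicator_of_mem h1, min_eq_left h1.2, key t ⟨h1.1.le, h1.2⟩]
  · rw [indicator_of_notMem h1]
    by_cases h2 : t ≤ a
    · rw [Ioc_eq_empty (by simp [h2]), setIntegral_empty]
    · rw [min_eq_right (by
        by_contra h3
        exact h1 ⟨not_le.1 h2, (not_le.1 h3).le⟩), key b ⟨hab, le_rfl⟩, hfb]

/-- If the form is nonnegative, a solution with two zeros `a < b` is trivial. The form vanishes on
`y` cut off outside `[a, b]`, so its first variation there vanishes in every direction; in the
direction of a bump at `b` the variation is `b y'(b)`. -/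
lemma FormNonneg.eq_zero_of_two_zeros (hQ : FormNonneg R P) (hP : ContinuousOn P (Ioo 0 R))
    (h : IsRadialSolution R P y z) {a b : ℝ} (ha : a ∈ Ioo 0 R) (hb : b ∈ Ioo 0 R) (hab : a < b)
    (hya : y a = 0) (hyb : y b = 0) : ∀ r ∈ Ioo 0 R, y r = 0 := by
  have hI : Icc a b ⊆ Ioo 0 R := fun x hx => ⟨ha.1.trans_le hx.1, hx.2.trans_lt hb.2⟩
  have hyc : ContinuousOn y (Ioo 0 R) := fun r hr => (h r hr).1.continuousAt.continuousWithinAt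
  have hzc : ContinuousOn z (Ioo 0 R) := fun r hr => (h r hr).2.continuousAt.continuousWithinAt
  have hz'c : ContinuousOn (fun r => z r / r) (Ioo 0 R) :=
    hzc.div continuousOn_id fun r hr => hr.1.ne'
  have hrPc : ContinuousOn (fun r => r * (P r * y r)) (Ioo 0 R) :=
    continuousOn_id.mul (hP.mul hyc)
  -- a bump at `b` so narrow that it vanishes at `a` and is supported in `(0, R)`
  obtain ⟨ρ, hρ, hρ'⟩ := exists_between (lt_min (sub_pos.2 hab) (sub_pos.2 hb.2))
  rw [lt_min_iff] at hρ'
  let η : ContDiffBump b := ⟨ρ / 2, ρ, by positivity, half_lt_self hρ⟩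
  have hηs : ContDiff ℝ ∞ η := η.contDiff
  have hηd : ∀ t, HasDerivAt η (deriv η t) t := fun t =>
    (hηs.differentiable (by simp) t).hasDerivAt
  have hη'c : Continuous (deriv η) := hηs.continuous_deriv (by simp)
  have hηb : η b = 1 := η.one_of_mem_closedBall (Metric.mem_closedBall_self (half_pos hρ).le)
  have hηz : ∀ t, ρ ≤ dist t b → η t = 0 := fun t ht => η.zero_of_le_dist ht
  have hηa : η a = 0 := hηz a (by rw [Real.dist_eq, abs_of_neg (by linarith)]; linarith)
  have hη0 : η 0 = 0 := hηz 0 (by rw [Real.dist_eq, abs_of_neg (by linarith [hb.1])]; linarith [ha.1])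
  have hη'z : ∀ t, t ∉ Icc a (b + ρ) → deriv η t = 0 := by
    intro t ht
    by_contra hne
    have h1 : t ∈ tsupport η := (tsupport_deriv_subset (𝕜 := ℝ)) (subset_tsupport _ hne)
    rw [η.tsupport_eq, Metric.mem_closedBall, Real.dist_eq, abs_le] at h1
    exact ht ⟨by linarith [h1.1], by simpa [η] using by linarith [h1.2]⟩
  -- `Y` is the cut-off solution, and `Y'` its almost everywhere derivative
  set Y := (Ioc a b).indicator y
  set Y' := (Ioc a b).indicator (fun r => z r / r)
  have hY : ∀ t, 0 ≤ t → ∫ s in (0 : ℝ)..t, Y' s = Y t := fun t ht =>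
    integral_indicator_deriv_of_endpoints_eq_zero ha.1.le hab.le (fun r hr => (h r (hI hr)).1)
      (hz'c.mono hI) hya hyb ht
  have hY'm : Measurable Y' := by
    have := (hz'c.mono (Ioc_subset_Icc_self.trans hI)).measurable_piecewise
      (g := 0) continuousOn_const measurableSet_Ioc
    simpa only [Y', ← piecewise_eq_indicator] using this
  obtain ⟨M₁, hM₁⟩ := isCompact_Icc.exists_bound_of_continuousOn (hz'c.mono hI)
  have hM₁0 : 0 ≤ M₁ := (norm_nonneg _).trans (hM₁ a ⟨le_rfl, hab.le⟩)
  have hY'b : ∀ t, |Y' t| ≤ M₁ := by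
    intro t
    by_cases ht : t ∈ Ioc a b
    · simpa only [Y', indicator_of_mem ht, Real.norm_eq_abs] using hM₁ t (Ioc_subset_Icc_self ht)
    · simpa [Y', indicator_of_notMem ht] using hM₁0
  obtain ⟨M₂, hM₂⟩ := (isCompact_Icc (a := a) (b := b + ρ)).exists_bound_of_continuousOn
    hη'c.continuousOn
  have hη'b : ∀ t, |deriv η t| ≤ |M₂| := by
    intro t
    by_cases ht : t ∈ Icc a (b + ρ)
    · exact (hM₂ t ht).trans (le_abs_self _)
    · simp [hη'z t ht]
  have hY'z : ∀ t, t ∉ Icc a (b + ρ) → Y' t = 0 := fun t ht =>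
    indicator_of_notMem (fun h' => ht ⟨h'.1.le, h'.2.trans (by linarith)⟩) _
  have hηint : ∀ t, ∫ s in (0 : ℝ)..t, deriv η s = η t := fun t => by
    rw [intervalIntegral.integral_eq_sub_of_hasDerivAt (fun s _ => hηd s)
      (hη'c.intervalIntegrable _ _), hη0, sub_zero]
  have hY'i : ∀ s t, IntervalIntegrable Y' volume s t := fun s t =>
    intervalIntegrable_iff.2 (Measure.integrableOn_of_bounded (M := M₁) (by simp)
      hY'm.aestronglyMeasurable (Eventually.of_forall fun x => by simpa using hY'b x))
  have hform : ∀ ε : ℝ, ∫ r in Ioo 0 R, r * (P r * (Y r + ε * η r) ^ 2)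
      ≤ ∫ r in Ioo 0 R, r * (Y' r + ε * deriv η r) ^ 2 := by
    intro ε
    have hw : ∀ t, 0 ≤ t → Y t + ε * η t = ∫ s in (0 : ℝ)..t, (Y' s + ε * deriv η s) := by
      intro t ht
      rw [intervalIntegral.integral_add (hY'i _ _) ((hη'c.intervalIntegrable _ _).const_mul ε),
        intervalIntegral.integral_const_mul, hY t ht, hηint]
    have hz0 : ∀ t, t ∉ Icc a (b + ρ) → Y' t + ε * deriv η t = 0 := fun t ht => by
      rw [hY'z t ht, hη'z t ht]; ring
    refine hQ.of_primitive hP ha.1 (d := b + ρ) (M := M₁ + |ε| * |M₂|) (by linarith)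
      (hY'm.add (hη'c.measurable.const_mul ε)) (fun t => ?_) hz0 ?_ fun t ht => hw t ht.1.le
    · refine (abs_add_le _ _).trans (add_le_add (hY'b t) ?_)
      rw [abs_mul]
      exact mul_le_mul_of_nonneg_left (hη'b t) (abs_nonneg _)
    · have h0 : 0 ≤ b + ρ := by linarith [hb.1]
      have h1 := hw (b + ρ) h0
      rw [intervalIntegral.integral_of_le h0, setIntegral_eq_integral_of_forall_compl_eq_zero,
        hηz _ (by simp [abs_of_pos hρ]), mul_zero, add_zero] at h1
      · rw [← h1]
        exact indicator_of_notMem (fun h' => by linarith [h'.2]) _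
      · exact fun t ht => hz0 t fun h' => ht ⟨ha.1.trans_le h'.1, h'.2⟩
  -- expansion of the form in powers of `ε`
  have hIoc : Ioc a b ⊆ Ioo 0 R := Ioc_subset_Icc_self.trans hI
  have int0 : IntegrableOn (fun r => z r * (z r / r) + -(r * (P r * y r)) * y r) (Ioc a b) :=
    (((hzc.mul hz'c).add (hrPc.neg.mul hyc)).mono hI).integrableOn_Icc.mono_set Ioc_subset_Icc_self
  have int1 : IntegrableOn (fun r => z r * deriv η r + -(r * (P r * y r)) * η r) (Ioc a b) :=
    (((hzc.mul hη'c.continuousOn).add (hrPc.neg.mul hηs.continuous.continuousOn)).mono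
      hI).integrableOn_Icc.mono_set Ioc_subset_Icc_self
  have q0 : ∫ r in Ioc a b, (z r * (z r / r) + -(r * (P r * y r)) * y r) = 0 := by
    rw [← intervalIntegral.integral_of_le hab.le,
      intervalIntegral.integral_eq_sub_of_hasDerivAt (f := fun r => z r * y r), hya, hyb]
    · ring
    · intro r hr
      rw [uIcc_of_le hab.le] at hr
      convert! (h r (hI hr)).2.mul (h r (hI hr)).1 using 1; ring
    · rw [intervalIntegrable_iff, uIoc_of_le hab.le]; exact int0
  have q1 : ∫ r in Ioc a b, (z r * deriv η r + -(r * (P r * y r)) * η r) = z b := by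
    rw [← intervalIntegral.integral_of_le hab.le,
      intervalIntegral.integral_eq_sub_of_hasDerivAt (f := fun r => z r * η r), hηa, hηb]
    · ring
    · intro r hr
      rw [uIcc_of_le hab.le] at hr
      convert! (h r (hI hr)).2.mul (hηd r) using 1; ring
    · rw [intervalIntegrable_iff, uIoc_of_le hab.le]; exact int1
  have hJ : Icc a (b + ρ) ⊆ Ioo 0 R := fun x hx =>
    ⟨ha.1.trans_le hx.1, hx.2.trans_lt (by linarith)⟩
  have zero_off : ∀ t, t ∉ Icc a (b + ρ) → η t = 0 := by
    intro t ht
    refine hηz t ?_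
    by_contra hlt
    rw [not_le, Real.dist_eq, abs_lt] at hlt
    exact ht ⟨by linarith [hlt.1], by linarith [hlt.2]⟩
  have intOn : ∀ f : ℝ → ℝ, ContinuousOn f (Ioo 0 R) → (∀ t, t ∉ Icc a (b + ρ) → f t = 0) →
      IntegrableOn f (Ioo 0 R) := by
    intro f hf hf0
    refine ((integrableOn_iff_integrable_of_support_subset (s := Icc a (b + ρ))
      fun t ht => ?_).1 (hf.mono hJ).integrableOn_Icc).integrableOn
    by_contra h'
    exact ht (hf0 t h')
  have intA : IntegrableOn (fun r => r * deriv η r ^ 2) (Ioo 0 R) :=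
    intOn _ (by fun_prop) fun t ht => by simp [hη'z t ht]
  have intB : IntegrableOn (fun r => r * (P r * η r ^ 2)) (Ioo 0 R) :=
    intOn _ (continuousOn_id.mul (hP.mul (hηs.continuous.pow 2).continuousOn))
      fun t ht => by simp [zero_off t ht]
  have indInt : ∀ f : ℝ → ℝ, IntegrableOn f (Ioc a b) →
      IntegrableOn ((Ioc a b).indicator f) (Ioo 0 R) := fun f hf =>
    ((integrable_indicator_iff measurableSet_Ioc).2 hf).integrableOn
  have cI : ∀ {f : ℝ → ℝ}, ContinuousOn f (Ioo 0 R) → IntegrableOn f (Ioc a b) := fun hf =>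
    (hf.mono hI).integrableOn_Icc.mono_set Ioc_subset_Icc_self
  have iz : ∀ f : ℝ → ℝ, ∫ r in Ioo 0 R, (Ioc a b).indicator f r = ∫ r in Ioc a b, f r := by
    intro f
    rw [setIntegral_indicator measurableSet_Ioc, inter_eq_right.2 hIoc]
  have eG : ∀ ε : ℝ, ∫ r in Ioo 0 R, r * (Y' r + ε * deriv η r) ^ 2
      = (∫ r in Ioc a b, z r * (z r / r)) + 2 * ε * (∫ r in Ioc a b, z r * deriv η r)
        + ε ^ 2 * ∫ r in Ioo 0 R, r * deriv η r ^ 2 := by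
    intro ε
    have i1 : IntegrableOn ((Ioc a b).indicator fun r => z r * (z r / r)) (Ioo 0 R) :=
      indInt _ (cI (hzc.mul hz'c))
    have i2 : IntegrableOn ((Ioc a b).indicator fun r => z r * deriv η r) (Ioo 0 R) :=
      indInt _ (cI (hzc.mul hη'c.continuousOn))
    rw [← iz, ← iz, ← integral_add_mul_add_mul i1 i2 intA]
    refine setIntegral_congr_fun measurableSet_Ioo fun r hr => ?_
    have hr0 : r ≠ 0 := hr.1.ne'
    by_cases hr' : r ∈ Ioc a b
    · simp only [Y', indicator_of_mem hr']
      field_simp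
      ring
    · simp only [Y', indicator_of_notMem hr']
      ring
  have eW : ∀ ε : ℝ, ∫ r in Ioo 0 R, r * (P r * (Y r + ε * η r) ^ 2)
      = (∫ r in Ioc a b, r * (P r * y r) * y r) + 2 * ε * (∫ r in Ioc a b, r * (P r * y r) * η r)
        + ε ^ 2 * ∫ r in Ioo 0 R, r * (P r * η r ^ 2) := by
    intro ε
    have i1 : IntegrableOn ((Ioc a b).indicator fun r => r * (P r * y r) * y r) (Ioo 0 R) :=
      indInt _ (cI (hrPc.mul hyc))
    have i2 : IntegrableOn ((Ioc a b).indicator fun r => r * (P r * y r) * η r) (Ioo 0 R) :=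
      indInt _ (cI (hrPc.mul hηs.continuous.continuousOn))
    rw [← iz, ← iz, ← integral_add_mul_add_mul i1 i2 intB]
    refine setIntegral_congr_fun measurableSet_Ioo fun r hr => ?_
    by_cases hr' : r ∈ Ioc a b
    · simp only [Y, indicator_of_mem hr']
      ring
    · simp only [Y, indicator_of_notMem hr']
      ring
  have hzb : z b = 0 := by
    refine eq_zero_of_forall_nonneg (q := (∫ r in Ioo 0 R, r * deriv η r ^ 2)
      - ∫ r in Ioo 0 R, r * (P r * η r ^ 2)) fun ε => ?_
    have h1 := hform ε
    rw [eG, eW] at h1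
    simp only [neg_mul, ← sub_eq_add_neg] at q0 q1
    replace q0 := (integral_sub (cI (hzc.mul hz'c)) (cI (hrPc.mul hyc))).symm.trans q0
    replace q1 := (integral_sub (cI (hzc.mul hη'c.continuousOn))
      (cI (hrPc.mul hηs.continuous.continuousOn))).symm.trans q1
    simp only [Pi.mul_apply] at q0 q1
    rw [← q1]
    linarith
  exact h.eq_zero hP hb hyb hzb

/-- Nonnegativity of the radial form yields a positive solution of the equation. -/
theorem FormNonneg.hasPositiveSolution (hR : 0 < R) (hP : ContinuousOn P (Ioo 0 R))
    (hQ : FormNonneg R P) : HasPositiveSolution R P :=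
  hasPositiveSolution_of_no_two_zeros hR hP fun _ _ h _ ha _ hb hab hya hyb =>
    hQ.eq_zero_of_two_zeros hP h ha hb hab hya hyb

end RadialEquation

/-! ### Test functions and radial functions on the ball -/

section TestFunctions

variable {n : ℕ} {Ω : Set (EuclideanSpace ℝ (Fin n))} {φ : EuclideanSpace ℝ (Fin n) → ℝ}

lemma norm_gradient (φ : EuclideanSpace ℝ (Fin n) → ℝ) (x : EuclideanSpace ℝ (Fin n)) :
    ‖gradient φ x‖ = ‖fderiv ℝ φ x‖ := by
  rw [gradient, LinearIsometryEquiv.norm_map]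

lemma inner_gradient (φ : EuclideanSpace ℝ (Fin n) → ℝ) (x v : EuclideanSpace ℝ (Fin n)) :
    inner ℝ (gradient φ x) v = fderiv ℝ φ x v := by
  rw [gradient, InnerProductSpace.toDual_symm_apply]

lemma _root_.IsTestFunction.continuous_gradient (hφ : IsTestFunction Ω φ) :
    Continuous (gradient φ) :=
  (LinearIsometryEquiv.continuous _).comp (hφ.1.continuous_fderiv (by simp))

lemma _root_.IsTestFunction.hasCompactSupport_gradient (hφ : IsTestFunction Ω φ) :
    HasCompactSupport (gradient φ) :=
  (hφ.2.1.fderiv (𝕜 := ℝ)).comp_left (g := (InnerProductSpace.toDual ℝ _).symm) (by simp)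

lemma _root_.IsTestFunction.isH10 (hφ : IsTestFunction Ω φ) : IsH10 Ω φ (gradient φ) := by
  have hc := hφ.1.continuous
  refine ⟨⟨(hc.memLp_of_hasCompactSupport hφ.2.1).restrict _,
    (hφ.continuous_gradient.memLp_of_hasCompactSupport hφ.hasCompactSupport_gradient).restrict _,
    hc.locallyIntegrable.locallyIntegrableOn _,
    hφ.continuous_gradient.locallyIntegrable.locallyIntegrableOn _, fun ψ hψ v => ?_⟩,
    fun _ => φ, fun _ => hφ, by simp, by simp⟩
  have hψc := hψ.1.continuous
  have hz : ∀ x, x ∉ Ω → ψ x = 0 := fun x hx => image_eq_zero_of_notMem_tsupport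
    fun h => hx (hψ.2.2 h)
  have hz' : ∀ x, x ∉ Ω → fderiv ℝ ψ x = 0 := fun x hx => image_eq_zero_of_notMem_tsupport
    fun h => hx (hψ.2.2 (tsupport_fderiv_subset ℝ h))
  rw [setIntegral_eq_integral_of_forall_compl_eq_zero fun x hx => by simp [hz' x hx],
    setIntegral_eq_integral_of_forall_compl_eq_zero fun x hx => by simp [hz x hx]]
  simp only [inner_gradient]
  have hdφ : Continuous fun x => fderiv ℝ φ x v :=
    (hφ.1.continuous_fderiv (by simp)).clm_apply continuous_const
  have hdψ : Continuous fun x => fderiv ℝ ψ x v :=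
    (hψ.1.continuous_fderiv (by simp)).clm_apply continuous_const
  refine integral_mul_fderiv_eq_neg_fderiv_mul_of_integrable ?_ ?_ ?_
    (fun x _ => hφ.1.differentiable (by simp) x) (fun x _ => hψ.1.differentiable (by simp) x)
  · exact (hdφ.mul hψc).integrable_of_hasCompactSupport hψ.2.1.mul_left
  · exact (hc.mul hdψ).integrable_of_hasCompactSupport hφ.2.1.mul_right
  · exact (hc.mul hψc).integrable_of_hasCompactSupport hφ.2.1.mul_right

end TestFunctions

/-- The area of the unit sphere of `ℝⁿ`, the constant of integration in polar coordinates. -/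
noncomputable def sphereArea (n : ℕ) : ℝ :=
  n * (volume : Measure (EuclideanSpace ℝ (Fin n))).real (Metric.ball 0 1)

lemma sphereArea_pos {n : ℕ} (hn : 0 < n) : 0 < sphereArea n := by
  have : NeZero n := ⟨hn.ne'⟩
  refine mul_pos (by exact_mod_cast hn) ?_
  exact ENNReal.toReal_pos (Metric.measure_ball_pos _ _ one_pos).ne' measure_ball_lt_top.ne

lemma setIntegral_ball_norm {n : ℕ} (hn : 0 < n) (R : ℝ) (F : ℝ → ℝ) :
    ∫ x in Metric.ball (0 : EuclideanSpace ℝ (Fin n)) R, F ‖x‖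
      = sphereArea n * ∫ r in Ioo 0 R, r ^ (n - 1) * F r := by
  have : NeZero n := ⟨hn.ne'⟩
  have h := integral_fun_norm_addHaar (volume : Measure (EuclideanSpace ℝ (Fin n)))
    ((Iio R).indicator F)
  rw [finrank_euclideanSpace_fin] at h
  have h1 : (fun x : EuclideanSpace ℝ (Fin n) => (Iio R).indicator F ‖x‖)
      = (Metric.ball 0 R).indicator fun x => F ‖x‖ := by
    ext x
    simp [indicator]
  have h2 : (fun r : ℝ => r ^ (n - 1) • (Iio R).indicator F r)
      = (Iio R).indicator fun r => r ^ (n - 1) * F r := by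
    ext r
    simp [indicator]
  rw [h1, h2, integral_indicator measurableSet_ball, setIntegral_indicator measurableSet_Iio,
    Ioi_inter_Iio] at h
  rw [h, sphereArea, nsmul_eq_mul, smul_eq_mul, mul_assoc]

section RadialTest

variable {n : ℕ} {R : ℝ} {w : ℝ → ℝ}

/-- The radial profile `r^{-(n-2)/2} w(r)` of the ground state transform. -/
noncomputable def profile (n : ℕ) (w : ℝ → ℝ) (r : ℝ) : ℝ := r ^ (-(((n : ℝ) - 2) / 2)) * w r

lemma tsupport_profile_subset : tsupport (profile n w) ⊆ tsupport w :=
  closure_mono fun r hr h => hr (by simp [profile, h])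

lemma contDiff_profile (hw : ContDiff ℝ ∞ w) (hw0 : tsupport w ⊆ Ioo 0 R) :
    ContDiff ℝ ∞ (profile n w) := by
  rw [contDiff_iff_contDiffAt]
  intro r
  by_cases hr : r ∈ tsupport w
  · exact (Real.contDiffAt_rpow_const_of_ne (hw0 hr).1.ne').mul hw.contDiffAt
  · exact contDiffAt_const (c := (0 : ℝ)).congr_of_eventuallyEq
      (notMem_tsupport_iff_eventuallyEq.1 fun h => hr (tsupport_profile_subset h))

lemma norm_mem_tsupport {x : EuclideanSpace ℝ (Fin n)}
    (hx : x ∈ tsupport fun x : EuclideanSpace ℝ (Fin n) => profile n w ‖x‖) : ‖x‖ ∈ tsupport w :=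
  tsupport_profile_subset (tsupport_comp_subset_preimage _ continuous_norm hx)

lemma isTestFunction_profile (hw : ContDiff ℝ ∞ w) (hw0 : tsupport w ⊆ Ioo 0 R) :
    IsTestFunction (Metric.ball 0 R) fun x : EuclideanSpace ℝ (Fin n) => profile n w ‖x‖ := by
  refine ⟨?_, ?_, fun x hx => by simpa using (hw0 (norm_mem_tsupport hx)).2⟩
  · rw [contDiff_iff_contDiffAt]
    intro x
    by_cases hx : x ∈ tsupport fun x : EuclideanSpace ℝ (Fin n) => profile n w ‖x‖
    · have hne : x ≠ 0 := norm_pos_iff.1 (hw0 (norm_mem_tsupport hx)).1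
      exact (contDiff_profile hw hw0).contDiffAt.comp x (contDiffAt_norm ℝ hne)
    · exact contDiffAt_const (c := (0 : ℝ)).congr_of_eventuallyEq
        (notMem_tsupport_iff_eventuallyEq.1 hx)
  · refine HasCompactSupport.of_support_subset_isCompact
      (isCompact_closedBall (0 : EuclideanSpace ℝ (Fin n)) R) fun x hx => ?_
    simpa using (hw0 (norm_mem_tsupport (subset_tsupport _ hx))).2.le

lemma norm_gradient_radial [NeZero n] {h : ℝ → ℝ} (hh : Differentiable ℝ h)
    {x : EuclideanSpace ℝ (Fin n)} (hx : x ≠ 0) :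
    ‖gradient (fun x : EuclideanSpace ℝ (Fin n) => h ‖x‖) x‖ = |deriv h ‖x‖| := by
  have hd : DifferentiableAt ℝ (fun x : EuclideanSpace ℝ (Fin n) => ‖x‖) x :=
    (contDiffAt_norm ℝ hx (n := 1)).differentiableAt (by simp)
  have h1 := (hh ‖x‖).hasDerivAt.comp_hasFDerivAt x hd.hasFDerivAt
  have h2 : fderiv ℝ (fun x : EuclideanSpace ℝ (Fin n) => h ‖x‖) x = _ := h1.fderiv
  rw [norm_gradient, h2, norm_smul, norm_fderiv_norm hd, mul_one, Real.norm_eq_abs]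

lemma pow_mul_profile_sq (hn : 2 ≤ n) {r : ℝ} (hr : 0 < r) :
    r ^ (n - 1) * (r ^ (-(((n : ℝ) - 2) / 2))) ^ 2 = r := by
  rw [← Real.rpow_natCast r (n - 1), ← Real.rpow_natCast (r ^ _) 2, ← Real.rpow_mul hr.le,
    ← Real.rpow_add hr, Nat.cast_sub (by omega)]
  convert Real.rpow_one r using 2
  push_cast
  ring

lemma integral_mul_deriv_eq_zero (hR : 0 < R) (hw : ContDiff ℝ ∞ w)
    (hw0 : tsupport w ⊆ Ioo 0 R) : ∫ r in Ioo 0 R, w r * deriv w r = 0 := by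
  have hd : ∀ r, HasDerivAt w (deriv w r) r := fun r =>
    (hw.differentiable (by simp) r).hasDerivAt
  have h0 : w 0 = 0 := image_eq_zero_of_notMem_tsupport fun h => (hw0 h).1.false
  have hwR : w R = 0 := image_eq_zero_of_notMem_tsupport fun h => (hw0 h).2.false
  rw [← integral_Ioc_eq_integral_Ioo, ← intervalIntegral.integral_of_le hR.le,
    intervalIntegral.integral_eq_sub_of_hasDerivAt (f := fun r => w r ^ 2 / 2), h0, hwR]
  · simp
  · intro r _
    convert! ((hd r).pow 2).div_const 2 using 1
    simp
    ring
  · exact (hw.continuous.mul (hw.continuous_deriv (by simp))).intervalIntegrable _ _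

lemma integrableOn_of_tsupport_subset (hw : Continuous w) (hwc : HasCompactSupport w)
    (hw0 : tsupport w ⊆ Ioo 0 R) {f : ℝ → ℝ} (hf : ContinuousOn f (Ioo 0 R)) :
    IntegrableOn (fun r => f r * w r) (Ioo 0 R) := by
  refine ((integrableOn_iff_integrable_of_support_subset (s := tsupport w) fun r hr => ?_).1
    (((hf.mul hw.continuousOn).mono hw0).integrableOn_compact hwc)).integrableOn
  refine subset_tsupport _ fun h => hr ?_
  simp [h]

lemma setIntegral_potential_profile (hn : 3 ≤ n) (R : ℝ) (P : ℝ → ℝ) :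
    ∫ x in Metric.ball (0 : EuclideanSpace ℝ (Fin n)) R, P ‖x‖ * profile n w ‖x‖ ^ 2
      = sphereArea n * ∫ r in Ioo 0 R, r * (P r * w r ^ 2) := by
  rw [setIntegral_ball_norm (by omega) R fun r => P r * profile n w r ^ 2]
  congr 1
  refine setIntegral_congr_fun measurableSet_Ioo fun r hr => ?_
  have := pow_mul_profile_sq (n := n) (by omega) hr.1
  simp only [profile]
  calc _ = (r ^ (n - 1) * (r ^ (-(((n : ℝ) - 2) / 2))) ^ 2) * (P r * w r ^ 2) := by ring
    _ = _ := by rw [this]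

lemma integrableOn_potential_profile (hn : 3 ≤ n) {P : ℝ → ℝ} (hP : ContinuousOn P (Ioo 0 R))
    (hw : ContDiff ℝ ∞ w) (hwc : HasCompactSupport w) (hw0 : tsupport w ⊆ Ioo 0 R) :
    IntegrableOn (fun x : EuclideanSpace ℝ (Fin n) => P ‖x‖ * profile n w ‖x‖ ^ 2)
      (Metric.ball 0 R) := by
  have : NeZero n := ⟨by omega⟩
  refine (integrableOn_fun_norm_addHaar volume (f := fun r => P r * profile n w r ^ 2)).2 ?_
  have h := integrableOn_of_tsupport_subset hw.continuous hwc hw0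
    ((continuousOn_id.mul hP).mul hw.continuous.continuousOn)
  refine h.congr_fun (fun r hr => ?_) measurableSet_Ioo
  have := pow_mul_profile_sq (n := n) (by omega) hr.1
  rw [finrank_euclideanSpace_fin]
  simp only [profile, smul_eq_mul, Pi.mul_apply, id]
  calc r * P r * w r * w r
      = (r ^ (n - 1) * (r ^ (-(((n : ℝ) - 2) / 2))) ^ 2) * (P r * w r ^ 2) := by rw [this]; ring
    _ = _ := by ring

/-- Under the ground state transform `u(x) = |x|^{-(n-2)/2} w(|x|)` the Hardy functional becomes
the one-dimensional form `∫ r w'²`. -/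
lemma hardyFunctional_profile (hn : 3 ≤ n) (hR : 0 < R) (hw : ContDiff ℝ ∞ w)
    (hwc : HasCompactSupport w) (hw0 : tsupport w ⊆ Ioo 0 R) :
    hardyFunctional (Metric.ball 0 R) (fun x : EuclideanSpace ℝ (Fin n) => profile n w ‖x‖)
      (gradient fun x : EuclideanSpace ℝ (Fin n) => profile n w ‖x‖)
      = sphereArea n * ∫ r in Ioo 0 R, r * deriv w r ^ 2 := by
  have : NeZero n := ⟨by omega⟩
  set m : ℝ := ((n : ℝ) - 2) / 2
  have hd : ∀ r, HasDerivAt w (deriv w r) r := fun r =>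
    (hw.differentiable (by simp) r).hasDerivAt
  have hw' : Continuous (deriv w) := hw.continuous_deriv (by simp)
  have hdp : ∀ r, 0 < r → deriv (profile n w) r = r ^ (-m) * (deriv w r - m * w r / r) := by
    intro r hr
    have h := (Real.hasDerivAt_rpow_const (p := -m) (Or.inl hr.ne')).mul (hd r)
    refine h.deriv.trans ?_
    rw [Real.rpow_sub_one hr.ne']
    ring
  have e1 : ∫ x in Metric.ball (0 : EuclideanSpace ℝ (Fin n)) R,
      ‖gradient (fun x : EuclideanSpace ℝ (Fin n) => profile n w ‖x‖) x‖ ^ 2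
      = sphereArea n * ∫ r in Ioo 0 R, r ^ (n - 1) * deriv (profile n w) r ^ 2 := by
    rw [← setIntegral_ball_norm (by omega) R fun r => deriv (profile n w) r ^ 2]
    refine integral_congr_ae (ae_restrict_of_ae ?_)
    filter_upwards [compl_mem_ae_iff.2 (measure_singleton (0 : EuclideanSpace ℝ (Fin n)))]
      with x hx
    rw [norm_gradient_radial ((contDiff_profile hw hw0).differentiable (by simp)) hx, sq_abs]
  have e2 : ∫ x in Metric.ball (0 : EuclideanSpace ℝ (Fin n)) R, profile n w ‖x‖ ^ 2 / ‖x‖ ^ 2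
      = sphereArea n * ∫ r in Ioo 0 R, r * (1 / r ^ 2 * w r ^ 2) := by
    rw [← setIntegral_potential_profile hn R fun r => 1 / r ^ 2]
    refine integral_congr_ae (Eventually.of_forall fun x => ?_)
    simp only
    ring
  have hts : tsupport (deriv w) ⊆ Ioo 0 R := (tsupport_deriv_subset (𝕜 := ℝ)).trans hw0
  have i1 : IntegrableOn (fun r => r * deriv w r ^ 2) (Ioo 0 R) :=
    (integrableOn_of_tsupport_subset hw' (hwc.deriv) hts
      (continuousOn_id.mul hw'.continuousOn)).congr_fun
      (fun r _ => by simp only [Pi.mul_apply, id]; ring) measurableSet_Ioo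
  have i2 : IntegrableOn (fun r => w r * deriv w r) (Ioo 0 R) :=
    integrableOn_of_tsupport_subset hw' (hwc.deriv) hts hw.continuous.continuousOn
  have i3 : IntegrableOn (fun r => r * (1 / r ^ 2 * w r ^ 2)) (Ioo 0 R) :=
    (integrableOn_of_tsupport_subset hw.continuous hwc hw0
      ((continuousOn_id.inv₀ fun r hr => hr.1.ne').mul hw.continuous.continuousOn)).congr_fun
      (fun r hr => by
        have := hr.1.ne'
        simp only [Pi.mul_apply, Pi.inv_apply, id]
        field_simp) measurableSet_Ioo
  have e3 : ∫ r in Ioo 0 R, r ^ (n - 1) * deriv (profile n w) r ^ 2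
      = (∫ r in Ioo 0 R, r * deriv w r ^ 2) + (-2 * m) * (∫ r in Ioo 0 R, w r * deriv w r)
        + m ^ 2 * ∫ r in Ioo 0 R, r * (1 / r ^ 2 * w r ^ 2) := by
    rw [← integral_add_mul_add_mul i1 i2 i3]
    refine setIntegral_congr_fun measurableSet_Ioo fun r hr => ?_
    have hr0 : r ≠ 0 := hr.1.ne'
    have h := pow_mul_profile_sq (n := n) (by omega) hr.1
    rw [hdp r hr.1]
    calc r ^ (n - 1) * (r ^ (-m) * (deriv w r - m * w r / r)) ^ 2
        = (r ^ (n - 1) * (r ^ (-m)) ^ 2) * (deriv w r - m * w r / r) ^ 2 := by ring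
      _ = r * (deriv w r - m * w r / r) ^ 2 := by rw [h]
      _ = _ := by field_simp; ring
  rw [hardyFunctional, e1, e2, e3, integral_mul_deriv_eq_zero hR hw hw0]
  ring

end RadialTest

/-! ### The one-dimensional inequality along rays -/

/-- The logarithmic derivative `v = r y' / y` of a positive solution `y` solves the Riccati equation
`r v' + v² + r² P = 0`. It is nonpositive: `r y'` is nonincreasing since `P ≥ 0`, and if it were
positive at one point, `y` would tend to `-∞` logarithmically at the origin. -/
lemma exists_riccati_of_hasPositiveSolution {R : ℝ} {P : ℝ → ℝ} (hP0 : ∀ r ∈ Ioo 0 R, 0 ≤ P r)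
    (h : HasPositiveSolution R P) :
    ∃ v : ℝ → ℝ, ∀ r ∈ Ioo 0 R, v r ≤ 0 ∧ HasDerivAt v (-(r * P r) - v r ^ 2 / r) r := by
  obtain ⟨y, hy, hy'⟩ := h
  have hyd : ∀ r ∈ Ioo 0 R, HasDerivAt y (deriv y r) r := fun r hr =>
    ((hy.differentiableOn (by simp)).differentiableAt (isOpen_Ioo.mem_nhds hr)).hasDerivAt
  have hydd : ∀ r ∈ Ioo 0 R, HasDerivAt (deriv y) (deriv (deriv y) r) r := by
    have e2 : (2 : WithTop ℕ∞) = 1 + 1 := by norm_num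
    rw [e2, contDiffOn_succ_iff_deriv_of_isOpen isOpen_Ioo] at hy
    exact fun r hr => ((hy.2.2.differentiableOn (by simp)).differentiableAt
      (isOpen_Ioo.mem_nhds hr)).hasDerivAt
  have hzd : ∀ r ∈ Ioo 0 R, HasDerivAt (fun r => r * deriv y r) (-(r * P r * y r)) r := by
    intro r hr
    have hr0 : r ≠ 0 := hr.1.ne'
    have e : deriv (deriv y) r = -(1 / r * deriv y r) - P r * y r := by linarith [(hy' r hr).2]
    convert! (hasDerivAt_id r).mul (hydd r hr) using 1
    rw [e]
    simp only [id]
    field_simp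
    ring
  have hanti : AntitoneOn (fun r => r * deriv y r) (Ioo 0 R) := by
    refine antitoneOn_of_deriv_nonpos (convex_Ioo 0 R)
      (fun r hr => (hzd r hr).continuousAt.continuousWithinAt)
      (fun r hr => (hzd r (interior_subset hr)).differentiableAt.differentiableWithinAt)
      fun r hr => ?_
    have hr := interior_subset hr
    rw [(hzd r hr).deriv, neg_nonpos]
    exact mul_nonneg (mul_nonneg hr.1.le (hP0 r hr)) (hy' r hr).1.le
  refine ⟨fun r => r * deriv y r / y r, fun r hr => ⟨?_, ?_⟩⟩
  · refine div_nonpos_of_nonpos_of_nonneg ?_ (hy' r hr).1.le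
    by_contra! hpos
    set k := r * deriv y r
    have hyr := (hy' r hr).1
    -- the point at which the logarithmic lower bound forces `y` to vanish
    set s := r * Real.exp (-(y r / k)) with hs
    have hs0 : 0 < s := mul_pos hr.1 (Real.exp_pos _)
    have hsr : s < r := by
      refine mul_lt_of_lt_one_right hr.1 (Real.exp_lt_one_iff.2 ?_)
      rw [neg_lt_zero]
      positivity
    have hsub : Icc s r ⊆ Ioo 0 R := fun t ht => ⟨hs0.trans_le ht.1, ht.2.trans_lt hr.2⟩
    have hd : ∀ t ∈ Icc s r,
        HasDerivAt (fun t => y t - k * Real.log t) (deriv y t - k * t⁻¹) t := fun t ht =>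
      (hyd t (hsub ht)).sub ((Real.hasDerivAt_log (hsub ht).1.ne').const_mul k)
    have hmono : MonotoneOn (fun t => y t - k * Real.log t) (Icc s r) := by
      refine monotoneOn_of_deriv_nonneg (convex_Icc s r)
        (fun t ht => (hd t ht).continuousAt.continuousWithinAt)
        (fun t ht => (hd t (interior_subset ht)).differentiableAt.differentiableWithinAt)
        fun t ht => ?_
      have ht := interior_subset ht
      have ht0 := (hsub ht).1
      rw [(hd t ht).deriv, sub_nonneg, ← div_eq_mul_inv, div_le_iff₀ ht0]
      have := hanti (hsub ht) hr ht.2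
      simp only at this
      linarith
    have h1 := hmono ⟨le_rfl, hsr.le⟩ ⟨hsr.le, le_rfl⟩ hsr.le
    have h2 : Real.log s = Real.log r - y r / k := by
      rw [hs, Real.log_mul hr.1.ne' (Real.exp_pos _).ne', Real.log_exp]; ring
    have h3 : k * (y r / k) = y r := by field_simp
    simp only [h2, mul_sub, h3] at h1
    linarith [(hy' s (hsub ⟨le_rfl, hsr.le⟩)).1]
  · have hr0 : r ≠ 0 := hr.1.ne'
    have hy0 : y r ≠ 0 := (hy' r hr).1.ne'
    convert! (hzd r hr).div (hyd r hr) hy0 using 1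
    field_simp

/-- The Hardy inequality with remainder on an interval `[ε, b]`, for `f` vanishing at `b`. With
`m = (n - 2) / 2` and `G = r^{n-2} (v - m) f²`, the difference of the two integrands is `G'` plus a
square, and the boundary term at `ε` has the right sign because `v ≤ 0 ≤ m`. -/
lemma intervalIntegral_hardy_le {R : ℝ} {P v f f' : ℝ → ℝ} (hP : ContinuousOn P (Ioo 0 R))
    (hv : ∀ r ∈ Ioo 0 R, v r ≤ 0 ∧ HasDerivAt v (-(r * P r) - v r ^ 2 / r) r)
    (hf : ∀ r, HasDerivAt f (f' r) r) (hf' : Continuous f') {n : ℕ} (hn : 3 ≤ n) {ε b : ℝ}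
    (hε : 0 < ε) (hεb : ε ≤ b) (hb : b < R) (hfb : f b = 0) :
    ∫ r in ε..b, r ^ (n - 1) * ((P r + (((n : ℝ) - 2) / 2) ^ 2 / r ^ 2) * f r ^ 2)
      ≤ ∫ r in ε..b, r ^ (n - 1) * f' r ^ 2 := by
  obtain ⟨k, rfl⟩ := Nat.exists_eq_add_of_le' hn
  have hm : (((k + 3 : ℕ) : ℝ) - 2) / 2 = ((k : ℝ) + 1) / 2 := by push_cast; ring
  rw [hm, show k + 3 - 1 = k + 2 by omega]
  set m : ℝ := ((k : ℝ) + 1) / 2 with hmdef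
  have hI : Icc ε b ⊆ Ioo 0 R := fun r hr => ⟨hε.trans_le hr.1, hr.2.trans_lt hb⟩
  have hfc : Continuous f := continuous_iff_continuousAt.2 fun r => (hf r).continuousAt
  have hvc : ContinuousOn v (Ioo 0 R) := fun r hr => (hv r hr).2.continuousAt.continuousWithinAt
  have hpow : ContinuousOn (fun r : ℝ => (r ^ 2)⁻¹) (Ioo 0 R) :=
    (continuousOn_id.pow 2).inv₀ fun r hr => pow_ne_zero 2 hr.1.ne'
  have cA : ContinuousOn (fun r => r ^ (k + 2) * ((P r + m ^ 2 / r ^ 2) * f r ^ 2)) (Icc ε b) :=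
    ContinuousOn.mono ((continuousOn_id.pow _).mul
      ((hP.add (continuousOn_const.mul hpow)).mul (hfc.pow 2).continuousOn)) hI
  have cB : ContinuousOn (fun r => r ^ (k + 2) * f' r ^ 2) (Icc ε b) := by fun_prop
  have cS : ContinuousOn (fun r => r ^ k * (r * f' r - (v r - m) * f r) ^ 2) (Icc ε b) :=
    ContinuousOn.mono ((continuousOn_id.pow _).mul (((continuousOn_id.mul hf'.continuousOn).sub
      ((hvc.sub continuousOn_const).mul hfc.continuousOn)).pow 2)) hI
  have ii : ∀ {F : ℝ → ℝ}, ContinuousOn F (Icc ε b) → IntervalIntegrable F volume ε b :=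
    fun hF => ContinuousOn.intervalIntegrable (by rwa [uIcc_of_le hεb])
  have hG : ∫ r in ε..b, (r ^ (k + 2) * f' r ^ 2
      - r ^ (k + 2) * ((P r + m ^ 2 / r ^ 2) * f r ^ 2)
      - r ^ k * (r * f' r - (v r - m) * f r) ^ 2)
      = b ^ (k + 1) * (v b - m) * f b ^ 2 - ε ^ (k + 1) * (v ε - m) * f ε ^ 2 := by
    refine intervalIntegral.integral_eq_sub_of_hasDerivAt
      (f := fun r => r ^ (k + 1) * (v r - m) * f r ^ 2) (fun r hr => ?_)
      (((ii cB).sub (ii cA)).sub (ii cS))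
    rw [uIcc_of_le hεb] at hr
    have hr0 : r ≠ 0 := (hI hr).1.ne'
    convert! ((hasDerivAt_pow (k + 1) r).mul ((hv r (hI hr)).2.sub_const m)).mul
      ((hf r).pow 2) using 1
    have hk : (k : ℝ) + 1 = 2 * m := by rw [hmdef]; ring
    push_cast
    rw [hk]
    simp only [Pi.pow_apply, Pi.mul_apply, pow_succ, pow_zero, one_mul]
    field_simp
    ring
  rw [intervalIntegral.integral_sub ((ii cB).sub (ii cA)) (ii cS),
    intervalIntegral.integral_sub (ii cB) (ii cA), hfb] at hG
  have hS : 0 ≤ ∫ r in ε..b, r ^ k * (r * f' r - (v r - m) * f r) ^ 2 :=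
    intervalIntegral.integral_nonneg hεb fun r hr =>
      mul_nonneg (pow_nonneg (hI hr).1.le _) (sq_nonneg _)
  have hbd : ε ^ (k + 1) * (v ε - m) * f ε ^ 2 ≤ 0 := by
    refine mul_nonpos_of_nonpos_of_nonneg (mul_nonpos_of_nonneg_of_nonpos (by positivity) ?_)
      (sq_nonneg _)
    have : 0 ≤ m := by positivity
    linarith [(hv ε (hI ⟨le_rfl, hεb⟩)).1]
  linarith

lemma lintegral_hardy_le {R : ℝ} {P v f f' : ℝ → ℝ} (hP : ContinuousOn P (Ioo 0 R))
    (hP0 : ∀ r ∈ Ioo 0 R, 0 ≤ P r)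
    (hv : ∀ r ∈ Ioo 0 R, v r ≤ 0 ∧ HasDerivAt v (-(r * P r) - v r ^ 2 / r) r)
    (hf : ∀ r, HasDerivAt f (f' r) r) (hf' : Continuous f') {n : ℕ} (hn : 3 ≤ n) {b : ℝ}
    (hb0 : 0 < b) (hb : b < R) (hfb : ∀ r, b ≤ r → f r = 0) :
    ∫⁻ r in Ioi (0 : ℝ), ENNReal.ofReal (r ^ (n - 1)) *
        ENNReal.ofReal ((P r + (((n : ℝ) - 2) / 2) ^ 2 / r ^ 2) * f r ^ 2)
      ≤ ∫⁻ r in Ioi (0 : ℝ), ENNReal.ofReal (r ^ (n - 1)) * ENNReal.ofReal (f' r ^ 2) := by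
  have hfc : Continuous f := continuous_iff_continuousAt.2 fun r => (hf r).continuousAt
  set A : ℝ → ℝ := fun r => r ^ (n - 1) * ((P r + (((n : ℝ) - 2) / 2) ^ 2 / r ^ 2) * f r ^ 2)
  set B : ℝ → ℝ := fun r => r ^ (n - 1) * f' r ^ 2
  have hpow : ContinuousOn (fun r : ℝ => (r ^ 2)⁻¹) (Ioo 0 R) :=
    (continuousOn_id.pow 2).inv₀ fun r hr => pow_ne_zero 2 hr.1.ne'
  have cA : ContinuousOn A (Ioo 0 R) := (continuousOn_id.pow _).mul
      ((hP.add (continuousOn_const.mul hpow)).mul (hfc.pow 2).continuousOn)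
  have cB : Continuous B := by fun_prop
  have eA : ∀ r ∈ Ioi (0 : ℝ), ENNReal.ofReal (r ^ (n - 1)) *
      ENNReal.ofReal ((P r + (((n : ℝ) - 2) / 2) ^ 2 / r ^ 2) * f r ^ 2)
      = (Ioc 0 b).indicator (fun r => ENNReal.ofReal (A r)) r := by
    intro r hr
    by_cases hrb : r ≤ b
    · rw [indicator_of_mem (show r ∈ Ioc 0 b from ⟨hr, hrb⟩), ENNReal.ofReal_mul (pow_nonneg (le_of_lt hr) _)]
    · rw [indicator_of_notMem (fun h : r ∈ Ioc 0 b => hrb h.2), hfb r (not_le.1 hrb).le]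
      simp
  have eB : ∀ r ∈ Ioi (0 : ℝ), ENNReal.ofReal (r ^ (n - 1)) * ENNReal.ofReal (f' r ^ 2)
      = ENNReal.ofReal (B r) := fun r hr =>
    (ENNReal.ofReal_mul (pow_nonneg (le_of_lt hr) _)).symm
  rw [setLIntegral_congr_fun measurableSet_Ioi eA, setLIntegral_congr_fun measurableSet_Ioi eB,
    setLIntegral_indicator measurableSet_Ioc, inter_eq_left.2 Ioc_subset_Ioi_self]
  have hU : Ioc 0 b = ⋃ k : ℕ, Ioc (b / (k + 1)) b := by
    ext r
    simp only [mem_Ioc, mem_iUnion]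
    constructor
    · rintro ⟨h1, h2⟩
      obtain ⟨k, hk⟩ := exists_nat_gt (b / r)
      refine ⟨k, ?_, h2⟩
      rw [div_lt_iff₀ h1] at hk
      rw [div_lt_iff₀ (by positivity)]
      nlinarith
    · rintro ⟨k, h1, h2⟩
      exact ⟨lt_trans (by positivity) h1, h2⟩
  have hmono : Monotone fun k : ℕ => Ioc (b / ((k : ℝ) + 1)) b := by
    intro i j hij
    refine Ioc_subset_Ioc_left ?_
    have : (i : ℝ) ≤ j := by exact_mod_cast hij
    gcongr
  rw [hU, setLIntegral_iUnion_of_directed _ hmono.directed_le]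
  refine iSup_le fun k => ?_
  have hε : 0 < b / ((k : ℝ) + 1) := by positivity
  have hεb : b / ((k : ℝ) + 1) ≤ b := div_le_self hb0.le (by linarith [k.cast_nonneg (α := ℝ)])
  have hI : Icc (b / ((k : ℝ) + 1)) b ⊆ Ioo 0 R := fun r hr =>
    ⟨hε.trans_le hr.1, hr.2.trans_lt hb⟩
  have hsub : Ioc (b / ((k : ℝ) + 1)) b ⊆ Ioi 0 := fun r hr => hε.trans hr.1
  refine le_trans ?_ (lintegral_mono_set hsub)
  have key := intervalIntegral_hardy_le hP hv hf hf' hn hε hεb hb (hfb b le_rfl)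
  rw [intervalIntegral.integral_of_le hεb, intervalIntegral.integral_of_le hεb] at key
  have nnA : 0 ≤ᵐ[volume.restrict (Ioc (b / ((k : ℝ) + 1)) b)] A := by
    filter_upwards [ae_restrict_mem measurableSet_Ioc] with r hr
    have hr' := hI (Ioc_subset_Icc_self hr)
    have := hP0 r hr'
    have := hr'.1
    simp only [A, Pi.zero_apply]
    positivity
  have nnB : 0 ≤ᵐ[volume.restrict (Ioc (b / ((k : ℝ) + 1)) b)] B := by
    filter_upwards [ae_restrict_mem measurableSet_Ioc] with r hr
    exact mul_nonneg (pow_nonneg (hsub hr).le _) (sq_nonneg _)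
  rw [← ofReal_integral_eq_lintegral_ofReal
      ((cA.mono hI).integrableOn_Icc.mono_set Ioc_subset_Icc_self) nnA,
    ← ofReal_integral_eq_lintegral_ofReal
      (cB.continuousOn.integrableOn_Icc.mono_set Ioc_subset_Icc_self) nnB]
  exact ENNReal.ofReal_le_ofReal key

/-! ### From rays to domains -/

/-- Integration in polar coordinates of a nonnegative function that need not be radial. -/
lemma lintegral_polar {n : ℕ} (hn : 0 < n) {F : EuclideanSpace ℝ (Fin n) → ℝ≥0∞}
    (hF : Measurable F) :
    ∫⁻ x, F x = ∫⁻ σ : Metric.sphere (0 : EuclideanSpace ℝ (Fin n)) 1,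
      (∫⁻ r in Ioi (0 : ℝ), ENNReal.ofReal (r ^ (n - 1)) * F (r • (σ : EuclideanSpace ℝ (Fin n))))
        ∂(volume : Measure (EuclideanSpace ℝ (Fin n))).toSphere := by
  have : NeZero n := ⟨hn.ne'⟩
  set μ : Measure (EuclideanSpace ℝ (Fin n)) := volume
  have h1 : ∫⁻ x, F x ∂μ = ∫⁻ x : ({(0)}ᶜ : Set (EuclideanSpace ℝ (Fin n))), F x ∂(μ.comap (↑)) := by
    rw [lintegral_subtype_comap (measurableSet_singleton _).compl, restrict_compl_singleton]
  have h2 := μ.measurePreserving_homeomorphUnitSphereProd.lintegral_comp_emb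
    (Homeomorph.measurableEmbedding _) (fun p => F ((p.2 : ℝ) • (p.1 : EuclideanSpace ℝ (Fin n))))
  have h3 : ∀ x : ({(0)}ᶜ : Set (EuclideanSpace ℝ (Fin n))),
      F (((homeomorphUnitSphereProd (EuclideanSpace ℝ (Fin n)) x).2 : ℝ) •
        ((homeomorphUnitSphereProd (EuclideanSpace ℝ (Fin n)) x).1 :
          EuclideanSpace ℝ (Fin n))) = F x := by
    intro x
    have := (homeomorphUnitSphereProd (EuclideanSpace ℝ (Fin n))).symm_apply_apply x
    conv_rhs => rw [← this]
    rfl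
  simp only [h3] at h2
  rw [h1, h2, lintegral_prod _ (by
    refine (hF.comp ?_).aemeasurable
    exact (measurable_subtype_coe.comp measurable_snd).smul
      (measurable_subtype_coe.comp measurable_fst))]
  refine lintegral_congr fun σ => ?_
  have hm : Measurable fun r : Ioi (0 : ℝ) => F ((r : ℝ) • (σ : EuclideanSpace ℝ (Fin n))) :=
    hF.comp (measurable_subtype_coe.smul_const _)
  rw [finrank_euclideanSpace_fin, Measure.volumeIoiPow]
  refine (lintegral_withDensity_eq_lintegral_mul _ (by fun_prop) hm).trans ?_
  exact lintegral_subtype_comap measurableSet_Ioi fun r : ℝ =>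
    ENNReal.ofReal (r ^ (n - 1)) * F (r • (σ : EuclideanSpace ℝ (Fin n)))

section Domain

variable {n : ℕ} {R : ℝ} {P : ℝ → ℝ} {Ω : Set (EuclideanSpace ℝ (Fin n))}

lemma ae_norm_mem_Ioo (hn : 0 < n) (hΩ : IsOpen Ω) (hΩR : Ω ⊆ Metric.ball 0 R) :
    ∀ᵐ x ∂(volume.restrict Ω), ‖x‖ ∈ Ioo 0 R := by
  have : NeZero n := ⟨hn.ne'⟩
  filter_upwards [ae_restrict_mem hΩ.measurableSet, ae_restrict_of_ae
    (compl_mem_ae_iff.2 (measure_singleton (0 : EuclideanSpace ℝ (Fin n))))] with x hx hx0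
  exact ⟨norm_pos_iff.2 hx0, by simpa using hΩR hx⟩

lemma measurable_indicator_Ioo (hP : ContinuousOn P (Ioo 0 R)) :
    Measurable ((Ioo 0 R).indicator P) := by
  have := hP.measurable_piecewise (g := 0) continuousOn_const measurableSet_Ioo
  simpa only [← piecewise_eq_indicator] using this

lemma aemeasurable_comp_norm (hn : 0 < n) (hΩ : IsOpen Ω) (hΩR : Ω ⊆ Metric.ball 0 R)
    (hP : ContinuousOn P (Ioo 0 R)) :
    AEMeasurable (fun x => P ‖x‖) (volume.restrict Ω) := by
  refine ⟨fun x => (Ioo 0 R).indicator P ‖x‖,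
    (measurable_indicator_Ioo hP).comp measurable_norm, ?_⟩
  filter_upwards [ae_norm_mem_Ioo hn hΩ hΩR] with x hx
  rw [indicator_of_mem hx]

/-- The improved Hardy inequality for test functions, obtained by integrating the one-dimensional
inequality over all rays. -/
lemma lintegral_hardy_testFunction_le (hn : 3 ≤ n) (hR : 0 < R) (hP : ContinuousOn P (Ioo 0 R))
    (hP0 : ∀ r ∈ Ioo 0 R, 0 ≤ P r) (hsol : HasPositiveSolution R P) (hΩ : IsOpen Ω)
    (hΩR : Ω ⊆ Metric.ball 0 R) {φ : EuclideanSpace ℝ (Fin n) → ℝ} (hφ : IsTestFunction Ω φ) :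
    ∫⁻ x in Ω, ENNReal.ofReal ((P ‖x‖ + (((n : ℝ) - 2) / 2) ^ 2 / ‖x‖ ^ 2) * φ x ^ 2)
      ≤ ∫⁻ x in Ω, ‖gradient φ x‖ₑ ^ 2 := by
  obtain ⟨v, hv⟩ := exists_riccati_of_hasPositiveSolution hP0 hsol
  -- `P` is arbitrary outside `(0, R)`; the cut-off is measurable, as polar coordinates require
  set Q := (Ioo 0 R).indicator P
  have hQP : ∀ r ∈ Ioo 0 R, Q r = P r := fun r hr => indicator_of_mem hr _
  have hQc : ContinuousOn Q (Ioo 0 R) := hP.congr hQP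
  have hQm : Measurable Q := measurable_indicator_Ioo hP
  have hφd : Differentiable ℝ φ := hφ.1.differentiable (by simp)
  obtain ⟨b, hb, hφb⟩ := exists_pos_lt_subset_ball hR (isClosed_tsupport φ) (hφ.2.2.trans hΩR)
  have hφ0 : ∀ x, b ≤ ‖x‖ → φ x = 0 := fun x hx => image_eq_zero_of_notMem_tsupport fun h => by
    have := hφb h
    rw [mem_ball_zero_iff] at this
    linarith
  have hφm : Measurable φ := hφ.1.continuous.measurable
  set F : EuclideanSpace ℝ (Fin n) → ℝ≥0∞ := fun x =>
    ENNReal.ofReal ((Q ‖x‖ + (((n : ℝ) - 2) / 2) ^ 2 / ‖x‖ ^ 2) * φ x ^ 2)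
  have hF : Measurable F := by
    have := hQm.comp (measurable_norm (α := EuclideanSpace ℝ (Fin n)))
    simp only [Function.comp_def] at this
    fun_prop
  have hG : Measurable fun x => ‖gradient φ x‖ₑ ^ 2 :=
    hφ.continuous_gradient.measurable.enorm.pow_const 2
  calc ∫⁻ x in Ω, ENNReal.ofReal ((P ‖x‖ + (((n : ℝ) - 2) / 2) ^ 2 / ‖x‖ ^ 2) * φ x ^ 2)
      = ∫⁻ x in Ω, F x := by
        refine lintegral_congr_ae ?_
        filter_upwards [ae_norm_mem_Ioo (by omega) hΩ hΩR] with x hx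
        simp only [F, hQP _ hx]
    _ ≤ ∫⁻ x, F x := setLIntegral_le_lintegral _ _
    _ ≤ ∫⁻ x, ‖gradient φ x‖ₑ ^ 2 := by
        rw [lintegral_polar (by omega) hF, lintegral_polar (by omega) hG]
        refine lintegral_mono fun σ => ?_
        set e : EuclideanSpace ℝ (Fin n) := σ.1
        have he : ‖e‖ = 1 := by simp [e]
        have hnorm : ∀ r ∈ Ioi (0 : ℝ), ‖r • e‖ = r := fun r hr => by
          rw [norm_smul, he, mul_one, Real.norm_of_nonneg (le_of_lt hr)]
        have hfd : ∀ r : ℝ, HasDerivAt (fun r => φ (r • e)) (fderiv ℝ φ (r • e) e) r := fun r => by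
          have h1 : HasDerivAt (fun r : ℝ => r • e) e r := by
            simpa using (hasDerivAt_id r).smul_const e
          exact (hφd (r • e)).hasFDerivAt.comp_hasDerivAt r h1
        have hfc : Continuous fun r : ℝ => fderiv ℝ φ (r • e) e :=
          ((hφ.1.continuous_fderiv (by simp)).comp (by fun_prop)).clm_apply continuous_const
        have key := lintegral_hardy_le hQc (fun r hr => by rw [hQP r hr]; exact hP0 r hr)
          (fun r hr => by rw [hQP r hr]; exact hv r hr) hfd hfc hn hb.1 hb.2
          (fun r hr => hφ0 _ (by rwa [hnorm r (hb.1.trans_le hr)]))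
        refine (le_of_eq ?_).trans (key.trans ?_)
        · refine setLIntegral_congr_fun measurableSet_Ioi fun r hr => ?_
          simp only [F, hnorm r hr]
        · refine lintegral_mono fun r => mul_le_mul_right ?_ _
          have h1 : |fderiv ℝ φ (r • e) e| ≤ ‖gradient φ (r • e)‖ := by
            have := (fderiv ℝ φ (r • e)).le_opNorm e
            rwa [he, mul_one, ← norm_gradient] at this
          rw [← ofReal_norm, ← ENNReal.ofReal_pow (norm_nonneg _), ← sq_abs]
          exact ENNReal.ofReal_le_ofReal (pow_le_pow_left₀ (abs_nonneg _) h1 2)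
    _ = ∫⁻ x in Ω, ‖gradient φ x‖ₑ ^ 2 := by
        rw [← lintegral_indicator hΩ.measurableSet]
        refine lintegral_congr fun x => ?_
        by_cases hx : x ∈ Ω
        · rw [indicator_of_mem hx]
        · have : fderiv ℝ φ x = 0 := image_eq_zero_of_notMem_tsupport
            fun h => hx (hφ.2.2 (tsupport_fderiv_subset ℝ h))
          rw [indicator_of_notMem hx, ← ofReal_norm, norm_gradient, this]
          simp

lemma eLpNorm_two_sq {α E : Type*} [MeasurableSpace α] [NormedAddCommGroup E] (μ : Measure α)
    (f : α → E) : eLpNorm f 2 μ ^ 2 = ∫⁻ x, ‖f x‖ₑ ^ 2 ∂μ := by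
  have := eLpNorm_nnreal_pow_eq_lintegral (f := f) (μ := μ) (p := 2) (by simp)
  simpa using this

/-- The improved Hardy inequality passes from test functions to `H¹₀`, by Fatou's lemma along an
almost everywhere convergent subsequence. -/
lemma lintegral_hardy_isH10_le (hn : 3 ≤ n) (hR : 0 < R) (hP : ContinuousOn P (Ioo 0 R))
    (hP0 : ∀ r ∈ Ioo 0 R, 0 ≤ P r) (hsol : HasPositiveSolution R P) (hΩ : IsOpen Ω)
    (hΩR : Ω ⊆ Metric.ball 0 R) {u : EuclideanSpace ℝ (Fin n) → ℝ}
    {g : EuclideanSpace ℝ (Fin n) → EuclideanSpace ℝ (Fin n)} (hu : IsH10 Ω u g) :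
    ∫⁻ x in Ω, ENNReal.ofReal ((P ‖x‖ + (((n : ℝ) - 2) / 2) ^ 2 / ‖x‖ ^ 2) * u x ^ 2)
      ≤ ∫⁻ x in Ω, ‖g x‖ₑ ^ 2 := by
  obtain ⟨⟨huL, hgL, -⟩, φ, hφ, hφu, hφg⟩ := hu
  have hm : TendstoInMeasure (volume.restrict Ω) φ atTop u := by
    refine tendstoInMeasure_of_tendsto_eLpNorm (p := 2) (by simp)
      (fun k => (hφ k).1.continuous.aestronglyMeasurable) huL.1 ?_
    refine hφu.congr fun k => ?_
    exact eLpNorm_sub_comm u (φ k) 2 _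
  obtain ⟨ns, hns, hlim⟩ := hm.exists_seq_tendsto_ae
  have hPm := aemeasurable_comp_norm (by omega) hΩ hΩR hP
  have hWm : AEMeasurable (fun x : EuclideanSpace ℝ (Fin n) =>
      P ‖x‖ + (((n : ℝ) - 2) / 2) ^ 2 / ‖x‖ ^ 2) (volume.restrict Ω) :=
    hPm.add (by fun_prop)
  have hFm : ∀ k, AEMeasurable (fun x => ENNReal.ofReal
      ((P ‖x‖ + (((n : ℝ) - 2) / 2) ^ 2 / ‖x‖ ^ 2) * φ k x ^ 2)) (volume.restrict Ω) := by
    intro k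
    have hφm : AEMeasurable (fun x => φ k x ^ 2) (volume.restrict Ω) :=
      ((hφ k).1.continuous.pow 2).aemeasurable
    exact (hWm.mul hφm).ennreal_ofReal
  rw [← eLpNorm_two_sq]
  calc ∫⁻ x in Ω, ENNReal.ofReal ((P ‖x‖ + (((n : ℝ) - 2) / 2) ^ 2 / ‖x‖ ^ 2) * u x ^ 2)
      = ∫⁻ x in Ω, liminf (fun k => ENNReal.ofReal
          ((P ‖x‖ + (((n : ℝ) - 2) / 2) ^ 2 / ‖x‖ ^ 2) * φ (ns k) x ^ 2)) atTop := by
        refine lintegral_congr_ae ?_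
        filter_upwards [hlim] with x hx
        exact (ENNReal.tendsto_ofReal ((hx.pow 2).const_mul _)).liminf_eq.symm
    _ ≤ liminf (fun k => ∫⁻ x in Ω, ENNReal.ofReal
          ((P ‖x‖ + (((n : ℝ) - 2) / 2) ^ 2 / ‖x‖ ^ 2) * φ (ns k) x ^ 2)) atTop :=
        lintegral_liminf_le' fun k => hFm (ns k)
    _ ≤ liminf (fun k => (eLpNorm g 2 (volume.restrict Ω)
          + eLpNorm (fun x => g x - gradient (φ (ns k)) x) 2 (volume.restrict Ω)) ^ 2) atTop := by
        refine liminf_le_liminf (Eventually.of_forall fun k => ?_)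
        refine (lintegral_hardy_testFunction_le hn hR hP hP0 hsol hΩ hΩR (hφ (ns k))).trans ?_
        rw [← eLpNorm_two_sq]
        have hgm : AEStronglyMeasurable (gradient (φ (ns k))) (volume.restrict Ω) :=
          (hφ (ns k)).continuous_gradient.aestronglyMeasurable
        have h2 := eLpNorm_sub_le (p := 2) hgL.1 (hgL.1.sub hgm) (by norm_num)
        rw [sub_sub_cancel] at h2
        exact pow_le_pow_left' h2 2
    _ = eLpNorm g 2 (volume.restrict Ω) ^ 2 := by
        have h1 := (tendsto_const_nhds (x := eLpNorm g 2 (volume.restrict Ω))).add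
          (hφg.comp hns.tendsto_atTop)
        rw [add_zero] at h1
        exact (((ENNReal.continuous_pow 2).tendsto _).comp h1).liminf_eq

/-- A positive solution of the radial equation makes `P` a Hardy improving potential. -/
theorem isHardyImproving_of_hasPositiveSolution (hn : 3 ≤ n) (hR : 0 < R)
    (hP : ContinuousOn P (Ioo 0 R)) (hP0 : ∀ r ∈ Ioo 0 R, 0 ≤ P r)
    (hsol : HasPositiveSolution R P) : IsHardyImproving n R P := by
  intro Ω hΩ _ hΩR u g hu
  have key := lintegral_hardy_isH10_le hn hR hP hP0 hsol hΩ hΩR hu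
  obtain ⟨⟨huL, hgL, -⟩, -⟩ := hu
  have hm0 : 0 < (((n : ℝ) - 2) / 2) ^ 2 := by
    have : (3 : ℝ) ≤ n := by exact_mod_cast hn
    have : 0 < ((n : ℝ) - 2) / 2 := by linarith
    positivity
  set M : ℝ := (((n : ℝ) - 2) / 2) ^ 2 with hM
  have hPm := aemeasurable_comp_norm (by omega) hΩ hΩR hP
  have hum := huL.1.aemeasurable
  have ham : AEMeasurable (fun x => P ‖x‖ * u x ^ 2) (volume.restrict Ω) := hPm.mul (hum.pow_const 2)
  have hqm : AEMeasurable (fun x => u x ^ 2 / ‖x‖ ^ 2) (volume.restrict Ω) :=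
    (hum.pow_const 2).div (by fun_prop)
  have ha0 : 0 ≤ᵐ[volume.restrict Ω] fun x => P ‖x‖ * u x ^ 2 := by
    filter_upwards [ae_norm_mem_Ioo (by omega) hΩ hΩR] with x hx
    exact mul_nonneg (hP0 _ hx) (sq_nonneg _)
  have hq0 : 0 ≤ᵐ[volume.restrict Ω] fun x => M * (u x ^ 2 / ‖x‖ ^ 2) :=
    Eventually.of_forall fun x => by simp only [Pi.zero_apply]; positivity
  have hg : Integrable (fun x => ‖g x‖ ^ 2) (volume.restrict Ω) :=
    (memLp_two_iff_integrable_sq_norm hgL.1).1 hgL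
  have hgi : ∫⁻ x in Ω, ‖g x‖ₑ ^ 2 = ENNReal.ofReal (∫ x in Ω, ‖g x‖ ^ 2) := by
    rw [ofReal_integral_eq_lintegral_ofReal hg (Eventually.of_forall fun x => sq_nonneg _)]
    refine lintegral_congr fun x => ?_
    rw [← ofReal_norm, ENNReal.ofReal_pow (norm_nonneg _)]
  have hsum : ∫⁻ x in Ω, ENNReal.ofReal ((P ‖x‖ + M / ‖x‖ ^ 2) * u x ^ 2)
      = (∫⁻ x in Ω, ENNReal.ofReal (P ‖x‖ * u x ^ 2))
        + ∫⁻ x in Ω, ENNReal.ofReal (M * (u x ^ 2 / ‖x‖ ^ 2)) := by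
    rw [← lintegral_add_left' ham.ennreal_ofReal]
    refine lintegral_congr_ae ?_
    filter_upwards [ha0, hq0] with x h1 h2
    rw [← ENNReal.ofReal_add h1 h2]
    congr 1
    ring
  rw [hsum, hgi] at key
  have hai : Integrable (fun x => P ‖x‖ * u x ^ 2) (volume.restrict Ω) :=
    (lintegral_ofReal_ne_top_iff_integrable ham.aestronglyMeasurable ha0).1
      ((le_self_add.trans key).trans_lt ENNReal.ofReal_lt_top).ne
  have hqi : Integrable (fun x => M * (u x ^ 2 / ‖x‖ ^ 2)) (volume.restrict Ω) :=
    (lintegral_ofReal_ne_top_iff_integrable (hqm.const_mul M).aestronglyMeasurable hq0).1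
      ((le_add_self.trans key).trans_lt ENNReal.ofReal_lt_top).ne
  have hqi' : Integrable (fun x => u x ^ 2 / ‖x‖ ^ 2) (volume.restrict Ω) := by
    refine (hqi.const_mul M⁻¹).congr (Eventually.of_forall fun x => ?_)
    simp only
    rw [inv_mul_cancel_left₀ hm0.ne']
  refine ⟨hqi', hai, ?_⟩
  rw [← ofReal_integral_eq_lintegral_ofReal hai ha0, ← ofReal_integral_eq_lintegral_ofReal hqi hq0,
    ← ENNReal.ofReal_add (integral_nonneg_of_ae ha0) (integral_nonneg_of_ae hq0),
    ENNReal.ofReal_le_ofReal_iff (integral_nonneg fun x => sq_nonneg _), integral_const_mul] at key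
  rw [hardyFunctional, ← hM]
  linarith

end Domain

/-! ### The best constant -/

section BestConstant

variable {n : ℕ} {R : ℝ} {P : ℝ → ℝ}

lemma isConnected_ball_zero (hR : 0 < R) :
    IsConnected (Metric.ball (0 : EuclideanSpace ℝ (Fin n)) R) :=
  (convex_ball 0 R).isConnected ⟨0, Metric.mem_ball_self hR⟩

/-- Testing the improved Hardy inequality with radial functions gives the one-dimensional form. -/
lemma formNonneg_of_forall_isH10 (hn : 3 ≤ n) (hR : 0 < R) (hP : ContinuousOn P (Ioo 0 R))
    (H : ∀ (u : EuclideanSpace ℝ (Fin n) → ℝ)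
      (g : EuclideanSpace ℝ (Fin n) → EuclideanSpace ℝ (Fin n)), IsH10 (Metric.ball 0 R) u g →
      IntegrableOn (fun x => P ‖x‖ * u x ^ 2) (Metric.ball 0 R) →
      ∫ x in Metric.ball 0 R, P ‖x‖ * u x ^ 2 ≤ hardyFunctional (Metric.ball 0 R) u g) :
    FormNonneg R P := by
  intro w hw hwc hw0
  have h := H _ _ (isTestFunction_profile hw hw0).isH10
    (integrableOn_potential_profile hn hP hw hwc hw0)
  rw [hardyFunctional_profile hn hR hw hwc hw0, setIntegral_potential_profile hn] at h
  exact le_of_mul_le_mul_left h (sphereArea_pos (by omega))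

/-- The function `1 - r² / (2 R²)` solves the equation for a potential bounded below by a positive
constant. -/
lemma hasPositiveSolution_one_sub_sq (hR : 0 < R) :
    HasPositiveSolution R fun r => 2 / R ^ 2 / (1 - r ^ 2 / (2 * R ^ 2)) := by
  have hd : ∀ r : ℝ, HasDerivAt (fun r : ℝ => 1 - r ^ 2 / (2 * R ^ 2)) (-(r / R ^ 2)) r := by
    intro r
    convert! ((hasDerivAt_pow 2 r).div_const (2 * R ^ 2)).const_sub 1 using 1
    simp only [Nat.cast_ofNat, Nat.add_one_sub_one, pow_one]
    field_simp
  have hd1 : deriv (fun r : ℝ => 1 - r ^ 2 / (2 * R ^ 2)) = fun r => -(r / R ^ 2) :=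
    funext fun r => (hd r).deriv
  have hd2 : ∀ r : ℝ, deriv (fun r : ℝ => -(r / R ^ 2)) r = -(1 / R ^ 2) := fun r =>
    ((hasDerivAt_id r).div_const (R ^ 2)).neg.deriv
  refine ⟨fun r => 1 - r ^ 2 / (2 * R ^ 2), by fun_prop, fun r hr => ?_⟩
  have hpos : 0 < 1 - r ^ 2 / (2 * R ^ 2) := by
    rw [sub_pos, div_lt_one (by positivity)]
    nlinarith [hr.1, hr.2]
  refine ⟨hpos, ?_⟩
  rw [hd1, hd2, div_mul_cancel₀ _ hpos.ne']
  have := hr.1.ne'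
  field_simp
  ring

/-- The Hardy functional is positive on nonzero functions of `H¹₀(B_R)`. -/
lemma hardyFunctional_pos (hn : 3 ≤ n) (hR : 0 < R) {u : EuclideanSpace ℝ (Fin n) → ℝ}
    {g : EuclideanSpace ℝ (Fin n) → EuclideanSpace ℝ (Fin n)} (hu : IsH10 (Metric.ball 0 R) u g)
    (hne : ¬ u =ᵐ[volume.restrict (Metric.ball 0 R)] 0) :
    0 < hardyFunctional (Metric.ball 0 R) u g := by
  set P₀ : ℝ → ℝ := fun r => 2 / R ^ 2 / (1 - r ^ 2 / (2 * R ^ 2))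
  have hden : ∀ r ∈ Ioo 0 R, 0 < 1 - r ^ 2 / (2 * R ^ 2) := by
    intro r hr
    rw [sub_pos, div_lt_one (by positivity)]
    nlinarith [hr.1, hr.2]
  have hpos : ∀ r ∈ Ioo 0 R, 0 < P₀ r := fun r hr => div_pos (by positivity) (hden r hr)
  have hc : ContinuousOn P₀ (Ioo 0 R) :=
    ContinuousOn.div continuousOn_const (by fun_prop) fun r hr => (hden r hr).ne'
  obtain ⟨-, hint, hle⟩ := isHardyImproving_of_hasPositiveSolution hn hR hc
    (fun r hr => (hpos r hr).le) (hasPositiveSolution_one_sub_sq hR) _ Metric.isOpen_ball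
    (isConnected_ball_zero hR) Subset.rfl u g hu
  refine lt_of_lt_of_le ?_ hle
  have hae := ae_norm_mem_Ioo (n := n) (R := R) (by omega) Metric.isOpen_ball Subset.rfl
  have h0 : 0 ≤ᵐ[volume.restrict (Metric.ball 0 R)] fun x => P₀ ‖x‖ * u x ^ 2 := by
    filter_upwards [hae] with x hx
    exact mul_nonneg (hpos _ hx).le (sq_nonneg _)
  refine (integral_nonneg_of_ae h0).lt_of_ne fun h => hne ?_
  filter_upwards [(integral_eq_zero_iff_of_nonneg_ae h0 hint).1 h.symm, hae] with x hx hx'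
  simpa [(hpos _ hx').ne'] using hx

lemma hardyFunctional_nonneg (hn : 3 ≤ n) (hR : 0 < R) {u : EuclideanSpace ℝ (Fin n) → ℝ}
    {g : EuclideanSpace ℝ (Fin n) → EuclideanSpace ℝ (Fin n)}
    (hu : IsH10 (Metric.ball 0 R) u g) : 0 ≤ hardyFunctional (Metric.ball 0 R) u g := by
  have hsol : HasPositiveSolution R fun _ => 0 :=
    ⟨fun _ => 1, contDiffOn_const, fun r _ => by simp⟩
  obtain ⟨-, -, hle⟩ := isHardyImproving_of_hasPositiveSolution hn hR continuousOn_const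
    (fun _ _ => le_rfl) hsol _ Metric.isOpen_ball (isConnected_ball_zero hR) Subset.rfl u g hu
  simpa using hle

lemma coe_mul_lintegral_ofReal (c : ℝ≥0) (u : EuclideanSpace ℝ (Fin n) → ℝ) :
    (c : ℝ≥0∞) * ∫⁻ x in Metric.ball 0 R, ENNReal.ofReal (P ‖x‖ * u x ^ 2)
      = ∫⁻ x in Metric.ball 0 R, ENNReal.ofReal (c * P ‖x‖ * u x ^ 2) := by
  rw [← lintegral_const_mul' _ _ ENNReal.coe_ne_top]
  refine lintegral_congr fun x => ?_
  rw [mul_assoc, ENNReal.ofReal_mul c.coe_nonneg, ENNReal.ofReal_coe_nnreal]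

lemma hasPositiveSolution_iff_le_hardyBestConstant (hn : 3 ≤ n) (hR : 0 < R)
    (hP : ContinuousOn P (Ioo 0 R)) (hP0 : ∀ r ∈ Ioo 0 R, 0 ≤ P r) (c : ℝ≥0) :
    HasPositiveSolution R (fun r => c * P r) ↔ (c : ℝ≥0∞) ≤ hardyBestConstant n R P := by
  have hcP : ContinuousOn (fun r => c * P r) (Ioo 0 R) := continuousOn_const.mul hP
  have hcP0 : ∀ r ∈ Ioo 0 R, 0 ≤ c * P r := fun r hr => mul_nonneg c.coe_nonneg (hP0 r hr)
  have hnn : ∀ u : EuclideanSpace ℝ (Fin n) → ℝ,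
      0 ≤ᵐ[volume.restrict (Metric.ball 0 R)] fun x => c * P ‖x‖ * u x ^ 2 := fun u => by
    filter_upwards [ae_norm_mem_Ioo (n := n) (R := R) (by omega) Metric.isOpen_ball Subset.rfl]
      with x hx
    exact mul_nonneg (hcP0 _ hx) (sq_nonneg _)
  constructor
  · intro hsol
    refine le_iInf fun u => le_iInf fun g => le_iInf fun hu => le_iInf fun hne => ?_
    obtain ⟨-, hint, hle⟩ := isHardyImproving_of_hasPositiveSolution hn hR hcP hcP0 hsol _
      Metric.isOpen_ball (isConnected_ball_zero hR) Subset.rfl u g hu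
    -- the numerator is positive, so the quotient is not the junk value `0 / 0 = 0`
    have hH := hardyFunctional_pos hn hR hu hne
    rw [ENNReal.le_div_iff_mul_le (Or.inr (ENNReal.ofReal_pos.2 hH).ne')
      (Or.inr ENNReal.ofReal_ne_top), coe_mul_lintegral_ofReal,
      ← ofReal_integral_eq_lintegral_ofReal hint (hnn u)]
    exact ENNReal.ofReal_le_ofReal hle
  · intro hc
    refine (formNonneg_of_forall_isH10 hn hR hcP fun u g hu hint => ?_).hasPositiveSolution hR hcP
    have hH := hardyFunctional_nonneg hn hR hu
    by_cases hne : u =ᵐ[volume.restrict (Metric.ball 0 R)] 0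
    · refine le_trans (le_of_eq (integral_eq_zero_of_ae ?_)) hH
      filter_upwards [hne] with x hx
      simp [hx]
    · have h1 : (c : ℝ≥0∞) ≤ ENNReal.ofReal (hardyFunctional (Metric.ball 0 R) u g) /
          ∫⁻ x in Metric.ball 0 R, ENNReal.ofReal (P ‖x‖ * u x ^ 2) :=
        hc.trans ((iInf_le _ u).trans ((iInf_le _ g).trans ((iInf_le _ hu).trans (iInf_le _ hne))))
      have h2 := ENNReal.mul_le_of_le_div h1
      rwa [coe_mul_lintegral_ofReal, ← ofReal_integral_eq_lintegral_ofReal hint (hnn u),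
        ENNReal.ofReal_le_ofReal_iff hH] at h2

end BestConstant

end HardyODE

theorem mainTheorem1 (n : ℕ) (hn : 3 ≤ n) (R : ℝ) (hR : 0 < R) (P : ℝ → ℝ)
    (hP : ContDiffOn ℝ 1 P (Set.Ioo 0 R)) (hP0 : ∀ r ∈ Set.Ioo 0 R, 0 ≤ P r) :
    (IsHardyImproving n R P ↔ HasPositiveSolution R P) ∧
    (hardyBestConstant n R P =
      ⨆ (c : ℝ≥0) (_ : HasPositiveSolution R (fun r => c * P r)), (c : ℝ≥0∞)) ∧
    (∀ c : ℝ≥0, HasPositiveSolution R (fun r => c * P r) ↔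
      (c : ℝ≥0∞) ≤ hardyBestConstant n R P) := by
  have hPc : ContinuousOn P (Set.Ioo 0 R) := hP.continuousOn
  have key := HardyODE.hasPositiveSolution_iff_le_hardyBestConstant hn hR hPc hP0
  refine ⟨⟨fun h => ?_, HardyODE.isHardyImproving_of_hasPositiveSolution hn hR hPc hP0⟩, ?_, key⟩
  · refine HardyODE.FormNonneg.hasPositiveSolution hR hPc
      (HardyODE.formNonneg_of_forall_isH10 hn hR hPc fun u g hu _ => ?_)
    exact (h _ Metric.isOpen_ball (HardyODE.isConnected_ball_zero hR) Set.Subset.rfl u g hu).2.2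
  · refine le_antisymm (ENNReal.le_of_forall_nnreal_lt fun c hc => ?_)
      (iSup₂_le fun c hc => (key c).1 hc)
    exact le_iSup₂_of_le c ((key c).2 hc.le) le_rfl
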